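/- **Theorem 2 (Performance guarantees of DADS-BS).** Let $\omega_{\rm b},C_{\rm f},L_{\rm f},R_{\rm f},L,R>0$, let $K_{\rm VC},K_{\rm CC},\mu_{\rm d},\mu_{\rm q},\Gamma_{\rm d},\Gamma_{\rm q},\varepsilon,\omega_{\rm pc},\omega_{\rm qc},\overline Q>0$, $\overline P\in(0,+\infty]$, $\xi_{\rm p},\xi_{\rm q}>1$, and $\omega_0,V_0,P_0,Q_0,K_{\rm P},K_{\rm Q}\in\mathbb R$. For $\overline x\in(0,+\infty]$ let $\operatorname{sat}_{\overline x}(y)$ be $\overline x$ if $y>\overline x$, $-\overline x$ if $y<-\overline x$, and $y$ otherwise. Put $$p=v_{\rm cd}i_{\rm gd}+v_{\rm cq}i_{\rm gq},\quad q=v_{\rm cq}i_{\rm gd}-v_{\rm cd}i_{\rm gq},\quad v_{\rm cd}^{\rm r}=V_0+K_{\rm Q}(Q_0-q_1),\quad \omega=\omega_0+K_{\rm P}(P_0-p_1),$$ $$i_{\rm td}^{\rm r}=i_{\rm gd}-C_{\rm f}\omega v_{\rm cq}-\tfrac{C_{\rm f}K_{\rm Q}}{\omega_{\rm b}}q_2-\tfrac{C_{\rm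 f}K_{\rm VC}}{\omega_{\rm b}}(v_{\rm cd}-v_{\rm cd}^{\rm r}),\qquad i_{\rm tq}^{\rm r}=i_{\rm gq}+C_{\rm f}\omega v_{\rm cd}-\tfrac{C_{\rm f}K_{\rm VC}}{\omega_{\rm b}}v_{\rm cq},$$ $$W_{\rm d}=\tfrac12(v_{\rm cd}-v_{\rm cd}^{\rm r})^2+\tfrac12(i_{\rm td}-i_{\rm td}^{\rm r})^2,\qquad W_{\rm q}=\tfrac12v_{\rm cq}^2+\tfrac12(i_{\rm tq}-i_{\rm tq}^{\rm r})^2,$$ $$u_{\rm d}=-\Big(K_{\rm CC}+\tfrac{(1+e^{z_{\rm d}})\omega_{\rm b}^2}{4\mu_{\rm d}}(1+i_{\rm gd}^2+v_{\rm cd}^2)\Big)(i_{\rm td}-i_{\rm td}^{\rm r})-\tfrac{\omega_{\rm b}}{C_{\rm f}}(v_{\rm cd}-v_{\rm cd}^{\rm r}),$$ $$u_{\rm q}=-\Big(K_{\rm CC}+\tfrac{(1+e^{z_{\rm q}})\omega_{\rm b}^2}{4\mu_{\rm q}}(1+i_{\rm gq}^2+v_{\rm cq}^2)\Big)(i_{\rm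 tq}-i_{\rm tq}^{\rm r})-\tfrac{\omega_{\rm b}}{C_{\rm f}}v_{\rm cq},$$ and let the DADS-BS terminal voltages be $$\begin{aligned}v_{\rm td}=\tfrac{L_{\rm f}}{\omega_{\rm b}}\Big[&-2\omega_{\rm b}\omega(i_{\rm tq}-i_{\rm gq})+\tfrac{\omega_{\rm b}R_{\rm f}}{L_{\rm f}}i_{\rm td}+\omega_{\rm b}\big(\tfrac1{L_{\rm f}}+\omega^2C_{\rm f}\big)v_{\rm cd}+C_{\rm f}K_{\rm P}p_2v_{\rm cq}-K_{\rm VC}(i_{\rm td}-i_{\rm td}^{\rm r})\\&+\tfrac{C_{\rm f}K_{\rm VC}^2}{\omega_{\rm b}}(v_{\rm cd}-v_{\rm cd}^{\rm r})+\tfrac{2\xi_{\rm q}\omega_{\rm qc}K_{\rm Q}C_{\rm f}}{\omega_{\rm b}}q_2+\tfrac{\omega_{\rm qc}^2K_{\rm Q}C_{\rm f}}{\omega_{\rm b}}\big(q_1-\operatorname{sat}_{\overline Q}(q)\big)+u_{\rm d}\Big],\end{aligned}$$ $$\begin{aligned}v_{\rm tq}=\tfrac{L_{\rm f}}{\omega_{\rm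 b}}\Big[&2\omega_{\rm b}\omega(i_{\rm td}-i_{\rm gd})+\tfrac{\omega_{\rm b}R_{\rm f}}{L_{\rm f}}i_{\rm tq}+\omega_{\rm b}\big(\tfrac1{L_{\rm f}}+C_{\rm f}\omega^2+\tfrac{C_{\rm f}K_{\rm VC}^2}{\omega_{\rm b}^2}\big)v_{\rm cq}-C_{\rm f}K_{\rm P}p_2v_{\rm cd}\\&-K_{\rm VC}(i_{\rm tq}-i_{\rm tq}^{\rm r})+u_{\rm q}\Big].\end{aligned}$$ For grid voltages $v_{\rm gd},v_{\rm gq}\in L^\infty(\mathbb R_+;\mathbb R)$ consider the closed loop $$\begin{aligned} \dot v_{\rm cd}&=\omega_{\rm b}\omega v_{\rm cq}+\tfrac{\omega_{\rm b}}{C_{\rm f}}(i_{\rm td}-i_{\rm gd}),&\dot v_{\rm cq}&=-\omega_{\rm b}\omega v_{\rm cd}+\tfrac{\omega_{\rm b}}{C_{\rm f}}(i_{\rm tq}-i_{\rm gq}),\\ \dot i_{\rm td}&=\omega_{\rm b}\omega i_{\rm tq}+\tfrac{\omega_{\rm b}}{L_{\rm f}}(v_{\rm td}-v_{\rm cd})-\tfrac{\omega_{\rm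 b}R_{\rm f}}{L_{\rm f}}i_{\rm td},&\dot i_{\rm tq}&=-\omega_{\rm b}\omega i_{\rm td}+\tfrac{\omega_{\rm b}}{L_{\rm f}}(v_{\rm tq}-v_{\rm cq})-\tfrac{\omega_{\rm b}R_{\rm f}}{L_{\rm f}}i_{\rm tq},\\ \dot i_{\rm gd}&=\omega_{\rm b}\omega i_{\rm gq}+\tfrac{\omega_{\rm b}}{L}(v_{\rm cd}-v_{\rm gd})-\tfrac{\omega_{\rm b}R}{L}i_{\rm gd},&\dot i_{\rm gq}&=-\omega_{\rm b}\omega i_{\rm gd}+\tfrac{\omega_{\rm b}}{L}(v_{\rm cq}-v_{\rm gq})-\tfrac{\omega_{\rm b}R}{L}i_{\rm gq},\\ \dot q_1&=q_2,&\dot q_2&=-2\xi_{\rm q}\omega_{\rm qc}q_2-\omega_{\rm qc}^2\big(q_1-\operatorname{sat}_{\overline Q}(q)\big),\\ \dot p_1&=p_2,&\dot p_2&=-2\xi_{\rm p}\omega_{\rm pc}p_2-\omega_{\rm pc}^2\big(p_1-\operatorname{sat}_{\overline P}(p)\big),\\ \dot z_{\rm d}&=\Gamma_{\rm d}e^{-z_{\rm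 d}}\max\{W_{\rm d}-\varepsilon,0\},&\dot z_{\rm q}&=\Gamma_{\rm q}e^{-z_{\rm q}}\max\{W_{\rm q}-\varepsilon,0\}. \end{aligned}$$ Then for every initial condition in $\mathbb R^{10}\times\mathbb R\times\mathbb R$ the closed loop has a unique (locally) absolutely continuous solution on $[0,\infty)$, the equations being satisfied for almost every $t\ge0$. With $k=\min\{K_{\rm VC},K_{\rm CC}\}$ and $\|\cdot\|_\infty$ the essential supremum norm on $[0,\infty)$, it satisfies, for all $t\ge0$, $$\big(v_{\rm cd}(t)-v_{\rm cd}^{\rm r}(t)\big)^2\le 2W_{\rm d}(t)\le 2e^{-2kt}W_{\rm d}(0)+\frac{\mu_{\rm d}\big(1+R^2+\|v_{\rm gd}\|_\infty^2\big)}{kL^2},$$ $$v_{\rm cq}(t)^2\le 2W_{\rm q}(t)\le 2e^{-2kt}W_{\rm q}(0)+\frac{\mu_{\rm q}\big(1+R^2+\|v_{\rm gq}\|_\infty^2\big)}{kL^2}.$$ Moreover, $$\limsup_{t\to+\infty}|v_{\rm cd}(t)-v_{\rm cd}^{\rm r}(t)|\le\sqrt{2\varepsilon},\qquad \limsup_{t\to+\infty}|v_{\rm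 cq}(t)|\le\sqrt{2\varepsilon}.$$ -/

import Mathlib

open MeasureTheory Filter

noncomputable section

namespace GFM

/-- Physical parameters on the inverter side of the point of common coupling (PCC):
base angular frequency and the output filter. -/
structure FilterParams where
  ωb : ℝ
  Cf : ℝ
  Lf : ℝ
  Rf : ℝ

/-- External network parameters: line inductance and resistance. The control laws below do not
have access to them. -/
structure NetworkParams where
  L : ℝ
  R : ℝ

/-- Controller design parameters, droop coefficients and setpoints. The active-power saturation
level `Pbar` may be `⊤` (no saturation). -/
structure DesignParams where
  KVC : ℝ
  KCC : ℝ
  μd : ℝ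
  μq : ℝ
  Γd : ℝ
  Γq : ℝ
  ε : ℝ
  ωpc : ℝ
  ωqc : ℝ
  ξp : ℝ
  ξq : ℝ
  Qbar : ℝ
  Pbar : EReal
  ω0 : ℝ
  V0 : ℝ
  P0 : ℝ
  Q0 : ℝ
  KP : ℝ
  KQ : ℝ

/-- Names of the closed-loop state variables: PCC voltage, terminal current and grid current in
the local dq frame, reactive- and active-power filter states, and the two adaptive gains. -/
inductive Coord
  | vcd | vcq | itd | itq | igd | igq | q1 | q2 | p1 | p2 | zd | zq
  deriving DecidableEq

instance : Fintype Coord where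
  elems := {.vcd, .vcq, .itd, .itq, .igd, .igq, .q1, .q2, .p1, .p2, .zd, .zq}
  complete c := by cases c <;> decide

/-- The closed-loop state space `ℝ¹⁰ × ℝ × ℝ`. -/
abbrev State := Coord → ℝ

/-- Saturation at a level in `(0, +∞]`. -/
def sat (X : EReal) (y : ℝ) : ℝ :=
  if X < (y : EReal) then X.toReal
  else if (y : EReal) < -X then -X.toReal
  else y

variable (F : FilterParams) (N : NetworkParams) (D : DesignParams) (x : State)

/-- Instantaneous active power at the PCC. -/
def activePower : ℝ := x .vcd * x .igd + x .vcq * x .igq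

/-- Instantaneous reactive power at the PCC. -/
def reactivePower : ℝ := x .vcq * x .igd - x .vcd * x .igq

/-- Droop-generated d-axis voltage reference (the q-axis reference is zero). -/
def vcdRef : ℝ := D.V0 + D.KQ * (D.Q0 - x .q1)

/-- Droop-generated electrical frequency. -/
def freq : ℝ := D.ω0 + D.KP * (D.P0 - x .p1)

/-- d-axis reference terminal current. -/
def itdRef : ℝ :=
  x .igd - F.Cf * freq D x * x .vcq - F.Cf * D.KQ / F.ωb * x .q2
    - F.Cf * D.KVC / F.ωb * (x .vcd - vcdRef D x)

/-- q-axis reference terminal current. -/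
def itqRef : ℝ :=
  x .igq + F.Cf * freq D x * x .vcd - F.Cf * D.KVC / F.ωb * x .vcq

/-- d-channel storage function. -/
def Wd : ℝ := 1 / 2 * (x .vcd - vcdRef D x) ^ 2 + 1 / 2 * (x .itd - itdRef F D x) ^ 2

/-- q-channel storage function. -/
def Wq : ℝ := 1 / 2 * x .vcq ^ 2 + 1 / 2 * (x .itq - itqRef F D x) ^ 2

/-- d-axis nonlinear damping input. -/
def ud : ℝ :=
  -(D.KCC + (1 + Real.exp (x .zd)) * F.ωb ^ 2 / (4 * D.μd) * (1 + x .igd ^ 2 + x .vcd ^ 2))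
      * (x .itd - itdRef F D x)
    - F.ωb / F.Cf * (x .vcd - vcdRef D x)

/-- q-axis nonlinear damping input. -/
def uq : ℝ :=
  -(D.KCC + (1 + Real.exp (x .zq)) * F.ωb ^ 2 / (4 * D.μq) * (1 + x .igq ^ 2 + x .vcq ^ 2))
      * (x .itq - itqRef F D x)
    - F.ωb / F.Cf * x .vcq

/-- d-axis terminal voltage commanded by the DADS-BS controller. -/
def vtd : ℝ :=
  F.Lf / F.ωb *
    (-2 * F.ωb * freq D x * (x .itq - x .igq) + F.ωb * F.Rf / F.Lf * x .itd
      + F.ωb * (1 / F.Lf + freq D x ^ 2 * F.Cf) * x .vcd + F.Cf * D.KP * x .p2 * x .vcq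
      - D.KVC * (x .itd - itdRef F D x)
      + F.Cf * D.KVC ^ 2 / F.ωb * (x .vcd - vcdRef D x)
      + 2 * D.ξq * D.ωqc * D.KQ * F.Cf / F.ωb * x .q2
      + D.ωqc ^ 2 * D.KQ * F.Cf / F.ωb * (x .q1 - sat D.Qbar (reactivePower x))
      + ud F D x)

/-- q-axis terminal voltage commanded by the DADS-BS controller. -/
def vtq : ℝ :=
  F.Lf / F.ωb *
    (2 * F.ωb * freq D x * (x .itd - x .igd) + F.ωb * F.Rf / F.Lf * x .itq
      + F.ωb * (1 / F.Lf + F.Cf * freq D x ^ 2 + F.Cf * D.KVC ^ 2 / F.ωb ^ 2) * x .vcq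
      - F.Cf * D.KP * x .p2 * x .vcd
      - D.KVC * (x .itq - itqRef F D x)
      + uq F D x)

/-- Right-hand side of the closed-loop dynamics when the grid voltage is `(vgd, vgq)`. -/
def closedLoop (vgd vgq : ℝ) : State
  | .vcd => F.ωb * freq D x * x .vcq + F.ωb / F.Cf * (x .itd - x .igd)
  | .vcq => -F.ωb * freq D x * x .vcd + F.ωb / F.Cf * (x .itq - x .igq)
  | .itd => F.ωb * freq D x * x .itq + F.ωb / F.Lf * (vtd F D x - x .vcd)
      - F.ωb * F.Rf / F.Lf * x .itd
  | .itq => -F.ωb * freq D x * x .itd + F.ωb / F.Lf * (vtq F D x - x .vcq)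
      - F.ωb * F.Rf / F.Lf * x .itq
  | .igd => F.ωb * freq D x * x .igq + F.ωb / N.L * (x .vcd - vgd)
      - F.ωb * N.R / N.L * x .igd
  | .igq => -F.ωb * freq D x * x .igd + F.ωb / N.L * (x .vcq - vgq)
      - F.ωb * N.R / N.L * x .igq
  | .q1 => x .q2
  | .q2 => -2 * D.ξq * D.ωqc * x .q2 - D.ωqc ^ 2 * (x .q1 - sat D.Qbar (reactivePower x))
  | .p1 => x .p2
  | .p2 => -2 * D.ξp * D.ωpc * x .p2 - D.ωpc ^ 2 * (x .p1 - sat D.Pbar (activePower x))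
  | .zd => D.Γd * Real.exp (-x .zd) * max (Wd F D x - D.ε) 0
  | .zq => D.Γq * Real.exp (-x .zq) * max (Wq F D x - D.ε) 0

/-- `X` is an absolutely continuous solution on `[0, ∞)` of the closed loop driven by the grid
voltage signals `vgd`, `vgq`, with initial state `x`: it is absolutely continuous on every compact
interval `[0, T]` and satisfies the differential equations for almost every `t ≥ 0`. Values of `X`
at negative times are irrelevant. -/
structure IsSolution (vgd vgq : ℝ → ℝ) (X : ℝ → State) : Prop where
  init : X 0 = x
  absCont : ∀ T : ℝ, 0 ≤ T → AbsolutelyContinuousOnInterval X 0 T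
  ode : ∀ᵐ t ∂(volume.restrict (Set.Ici (0 : ℝ))),
    HasDerivAt X (closedLoop F N D (X t) (vgd t) (vgq t)) t

/-- Membership in `L^∞(ℝ₊; ℝ)`; the function is only looked at on `[0, ∞)`. -/
def MemLinfty (v : ℝ → ℝ) : Prop := MemLp v ⊤ (volume.restrict (Set.Ici (0 : ℝ)))

/-- The essential supremum of `|v|` over `[0, ∞)`. -/
def normLinfty (v : ℝ → ℝ) : ℝ := (eLpNorm v ⊤ (volume.restrict (Set.Ici (0 : ℝ)))).toReal

end GFM

end

/-! ### Absolutely continuous functions and Grönwall's inequality. -/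

section AbsolutelyContinuous

open Set Topology

/-! In each channel the controller is a backstepping design. With `a` the voltage error and `b` the
current error, the control laws cancel every known term and leave `a' = c b - KVC a` and `b' = u +
(ωb / L) (w + R i - v)`, where only the last bracket involves the unknown grid
(`hasDerivAt_vcd_error`, `hasDerivAt_itd_error` and their q-axis twins). The damping in `u` grows
like `1 + i² + v²`, so Cauchy–Schwarz and Young's inequality (`damping_estimate`) give `W' ≤ -2k W +
M / (1 + exp z)` with `M = μ (1 + R² + ‖w‖²) / L²`. Bounding the last term by `M`, Grönwall yields
the exponential estimates.

For the limsup (`eventually_le_of_adaptive_gain`), `z` is nondecreasing. If it is bounded, `W`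
cannot keep exceeding `ε` by a fixed margin, since each excursion would raise `z` by a fixed amount.
If it is unbounded, the disturbance term tends to zero and so does its contribution to `W`.

Existence and uniqueness: the grid voltage is merely measurable in time but enters additively, so
subtracting a primitive of it gives an equation continuous in time and locally Lipschitz in the
state. Global existence follows by truncating the field and using the a priori bounds of
`exists_bound_reachable`. -/

theorem AbsolutelyContinuousOnInterval.congr {X : Type*} [PseudoMetricSpace X] {f g : ℝ → X}
    {a b : ℝ} (hf : AbsolutelyContinuousOnInterval f a b) (hfg : EqOn f g (uIcc a b)) :
    AbsolutelyContinuousOnInterval g a b := by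
  rw [absolutelyContinuousOnInterval_iff] at hf ⊢
  intro ε hε
  obtain ⟨δ, hδ, h⟩ := hf ε hε
  refine ⟨δ, hδ, fun E hE hlt => ?_⟩
  convert h E hE hlt using 1
  refine Finset.sum_congr rfl fun i hi => ?_
  rw [hfg (hE.1 i hi).1, hfg (hE.1 i hi).2]

theorem LipschitzOnWith.comp_absolutelyContinuousOnInterval {X Y : Type*} [PseudoMetricSpace X]
    [PseudoMetricSpace Y] {g : X → Y} {s : Set X} {K : NNReal} (hg : LipschitzOnWith K g s)
    {f : ℝ → X} {a b : ℝ} (hf : AbsolutelyContinuousOnInterval f a b)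
    (hs : MapsTo f (uIcc a b) s) :
    AbsolutelyContinuousOnInterval (g ∘ f) a b := by
  rw [absolutelyContinuousOnInterval_iff] at hf ⊢
  intro ε hε
  obtain ⟨δ, hδ, h⟩ := hf (ε / (K + 1)) (by positivity)
  refine ⟨δ, hδ, fun E hE hlt => ?_⟩
  have h1 := h E hE hlt
  rw [lt_div_iff₀ (by positivity)] at h1
  refine lt_of_le_of_lt ?_ h1
  rw [Finset.sum_mul]
  refine Finset.sum_le_sum fun i hi => ?_
  have h2 := hg.dist_le_mul _ (hs (hE.1 i hi).1) _ (hs (hE.1 i hi).2)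
  have h3 := dist_nonneg (x := f (E.2 i).1) (y := f (E.2 i).2)
  simp only [Function.comp_apply]
  nlinarith

/-- On the compact image of the interval one Lipschitz constant suffices. This transfers absolute
continuity from trajectories to storage functions. -/
theorem LocallyLipschitz.comp_absolutelyContinuousOnInterval {X Y : Type*}
    [SeminormedAddCommGroup X] [PseudoMetricSpace Y] {g : X → Y} (hg : LocallyLipschitz g)
    {f : ℝ → X} {a b : ℝ}
    (hf : AbsolutelyContinuousOnInterval f a b) : AbsolutelyContinuousOnInterval (g ∘ f) a b := by
  have hc : IsCompact (f '' uIcc a b) := isCompact_uIcc.image_of_continuousOn hf.continuousOn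
  obtain ⟨K, hK⟩ : ∃ K, LipschitzOnWith K g (f '' uIcc a b) :=
    LocallyLipschitzOn.exists_lipschitzOnWith_of_compact hc hg.locallyLipschitzOn
  exact hK.comp_absolutelyContinuousOnInterval hf (mapsTo_image _ _)

theorem absolutelyContinuousOnInterval_const {X : Type*} [PseudoMetricSpace X] (c : X) (a b : ℝ) :
    AbsolutelyContinuousOnInterval (fun _ => c) a b :=
  (LipschitzWith.const c).lipschitzOnWith.absolutelyContinuousOnInterval

/-- An absolutely continuous function with nonpositive derivative almost everywhere does not
increase. -/
theorem AbsolutelyContinuousOnInterval.le_of_ae_deriv_nonpos {f : ℝ → ℝ} {a b : ℝ} (hab : a ≤ b)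
    (hf : AbsolutelyContinuousOnInterval f a b)
    (hd : ∀ᵐ t, t ∈ Icc a b → ∃ f', HasDerivAt f f' t ∧ f' ≤ 0) : f b ≤ f a := by
  have h := hf.integral_deriv_eq_sub
  have h0 : ∫ x in a..b, deriv f x ≤ ∫ _ in a..b, (0 : ℝ) := by
    refine intervalIntegral.integral_mono_ae_restrict hab hf.intervalIntegrable_deriv (by simp) ?_
    rw [EventuallyLE, ae_restrict_iff' measurableSet_Icc]
    filter_upwards [hd] with t ht htm
    obtain ⟨f', h1, h2⟩ := ht htm
    simpa [h1.deriv] using h2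
  simp at h0
  linarith

theorem AbsolutelyContinuousOnInterval.le_add_of_ae_deriv_le {f : ℝ → ℝ} {a b m : ℝ} (hab : a ≤ b)
    (hf : AbsolutelyContinuousOnInterval f a b)
    (hd : ∀ᵐ t, t ∈ Icc a b → ∃ f', HasDerivAt f f' t ∧ f' ≤ m) : f b ≤ f a + m * (b - a) := by
  have hl : AbsolutelyContinuousOnInterval (fun t : ℝ => m * t) a b :=
    ContDiffOn.absolutelyContinuousOnInterval (by fun_prop)
  have := (hf.fun_sub hl).le_of_ae_deriv_nonpos hab (by
    filter_upwards [hd] with t ht htm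
    obtain ⟨f', h1, h2⟩ := ht htm
    exact ⟨f' - m * 1, h1.sub ((hasDerivAt_id t).const_mul m), by linarith⟩)
  linarith

/-- Grönwall's inequality for an absolutely continuous function. -/
theorem AbsolutelyContinuousOnInterval.gronwall_le {f : ℝ → ℝ} {a b c m : ℝ} (hab : a ≤ b)
    (hc : c ≠ 0) (hf : AbsolutelyContinuousOnInterval f a b)
    (hd : ∀ᵐ t, t ∈ Icc a b → ∃ f', HasDerivAt f f' t ∧ f' ≤ -c * f t + m) :
    f b ≤ Real.exp (-c * (b - a)) * (f a - m / c) + m / c := by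
  have hl : AbsolutelyContinuousOnInterval (fun t : ℝ => Real.exp (c * t)) a b :=
    ContDiffOn.absolutelyContinuousOnInterval (by fun_prop)
  -- Integrating factor `exp (c t)`, applied to `f` shifted by the equilibrium `m / c`. Either sign
  -- of `c` works; a negative one gives growth bounds.
  have hg := hl.fun_mul (hf.fun_sub (absolutelyContinuousOnInterval_const (m / c) a b))
  have h := hg.le_of_ae_deriv_nonpos hab (by
    filter_upwards [hd] with t ht htm
    obtain ⟨f', h1, h2⟩ := ht htm
    refine ⟨_, (((hasDerivAt_id t).const_mul c).exp).mul (h1.sub_const (m / c)), ?_⟩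
    have h3 : c * (m / c) = m := by field_simp
    have : Real.exp (c * t) * (c * 1) * (f t - m / c) + Real.exp (c * t) * f'
        = Real.exp (c * t) * (f' + c * f t - m) := by
      linear_combination (-Real.exp (c * t)) * h3
    simp only [id] at this ⊢
    rw [this]
    exact mul_nonpos_of_nonneg_of_nonpos (Real.exp_pos _).le (by linarith))
  have e : Real.exp (-c * (b - a)) = Real.exp (c * a) / Real.exp (c * b) := by
    rw [← Real.exp_sub]; ring_nf
  rw [e, ← sub_le_iff_le_add, div_mul_eq_mul_div, le_div_iff₀ (Real.exp_pos _)]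
  linarith

end AbsolutelyContinuous

/-! ### Carathéodory solutions with additive forcing: uniqueness, existence, gluing. -/

section ODE

open Set Topology

/-- `X` is an absolutely continuous solution on `[0, T]` of `X' = f X + d`, `X 0 = x₀`. -/
structure IsACSolOn {E : Type*} [NormedAddCommGroup E] [NormedSpace ℝ E] (f : E → E) (d : ℝ → E)
    (x₀ : E) (T : ℝ) (X : ℝ → E) : Prop where
  init : X 0 = x₀
  ac : AbsolutelyContinuousOnInterval X 0 T
  ode : ∀ᵐ t, t ∈ Icc 0 T → HasDerivAt X (f (X t) + d t) t

namespace IsACSolOn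

variable {E : Type*} [NormedAddCommGroup E] [NormedSpace ℝ E] {f : E → E} {d : ℝ → E} {x₀ : E}
  {T : ℝ} {X Y : ℝ → E}

theorem mono (h : IsACSolOn f d x₀ T X) {S : ℝ} (h0 : 0 ≤ S) (hS : S ≤ T) :
    IsACSolOn f d x₀ S X where
  init := h.init
  ac := h.ac.mono (by
    rw [uIcc_of_le h0, uIcc_of_le (h0.trans hS)]
    exact Icc_subset_Icc_right hS)
  ode := by
    filter_upwards [h.ode] with t ht htm using ht ⟨htm.1, htm.2.trans hS⟩

theorem continuousOn (h : IsACSolOn f d x₀ T X) (hT : 0 ≤ T) : ContinuousOn X (Icc 0 T) := by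
  simpa [uIcc_of_le hT] using h.ac.continuousOn

/-- Subtracting a primitive `G` of the forcing term turns an absolutely continuous solution into a
classical one. -/
theorem hasDerivWithinAt_sub [CompleteSpace E] (h : IsACSolOn f d x₀ T X) (hT : 0 ≤ T)
    (hf : Continuous f)
    {G : ℝ → E} (hG : AbsolutelyContinuousOnInterval G 0 T)
    (hGd : ∀ᵐ t, t ∈ Icc 0 T → HasDerivAt G (d t) t) {t : ℝ} (ht : t ∈ Ico 0 T) :
    HasDerivWithinAt (fun s => X s - G s) (f (X t)) (Ici t) t := by
  -- Freezing `X` outside `[0, T]` makes the integrand continuous on the whole line, so its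
  -- primitive `I` is `C¹` everywhere.
  set Z : ℝ → E := IccExtend hT ((Icc 0 T).domRestrict X) with hZ
  have hZc : Continuous Z :=
    (continuousOn_iff_continuous_domRestrict.1 (h.continuousOn hT)).Icc_extend'
  have hZX : ∀ s ∈ Icc 0 T, Z s = X s := fun s hs => by
    rw [hZ, IccExtend_of_mem hT _ hs]; rfl
  set I : ℝ → E := fun s => ∫ u in (0 : ℝ)..s, f (Z u) with hI
  have hfZ : Continuous fun u => f (Z u) := hf.comp hZc
  have hId : ∀ s, HasDerivAt I (f (Z s)) s := fun s =>
    hfZ.integral_hasStrictDerivAt 0 s |>.hasDerivAt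
  have hIC : ContDiff ℝ 1 I := by
    rw [contDiff_one_iff_deriv]
    refine ⟨fun s => (hId s).differentiableAt, ?_⟩
    rw [show deriv I = fun s => f (Z s) from funext fun s => (hId s).deriv]
    exact hfZ
  -- `X - G - I` is absolutely continuous with zero derivative almost everywhere, hence constant.
  have hac := (h.ac.fun_sub hG).fun_sub
    (hIC.contDiffOn.absolutelyContinuousOnInterval (a := 0) (b := T))
  obtain ⟨C, hC⟩ := hac.const_of_ae_hasDerivAt_zero (by
    filter_upwards [h.ode, hGd] with s hs hs' hsm
    rw [uIcc_of_le hT] at hsm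
    have := ((hs hsm).sub (hs' hsm)).sub (hId s)
    rw [hZX s hsm] at this
    simpa using! this)
  rw [uIcc_of_le hT] at hC
  have hd : HasDerivWithinAt (fun s => C + I s) (f (X t)) (Ici t) t := by
    rw [← hZX t ⟨ht.1, ht.2.le⟩]
    exact ((hId t).const_add C).hasDerivWithinAt
  refine hd.congr_of_eventuallyEq ?_ ?_
  · filter_upwards [Ico_mem_nhdsGE ht.2] with s hs
    have := hC s ⟨ht.1.trans hs.1, hs.2.le⟩
    rw [← this]; abel
  · have := hC t ⟨ht.1, ht.2.le⟩
    rw [← this]; abel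

/-- `X - G` and `Y - G` are classical solutions of `y' = f (y + G t)`. The region of Lipschitz
continuity moves with `t`: it is the translate by `-G t` of a fixed ball containing both
trajectories. -/
theorem eqOn [FiniteDimensional ℝ E] (hX : IsACSolOn f d x₀ T X) (hY : IsACSolOn f d x₀ T Y)
    (hT : 0 ≤ T) (hf : LocallyLipschitz f)
    {G : ℝ → E} (hG : AbsolutelyContinuousOnInterval G 0 T)
    (hGd : ∀ᵐ t, t ∈ Icc 0 T → HasDerivAt G (d t) t) : EqOn X Y (Icc 0 T) := by
  have : ProperSpace E := FiniteDimensional.proper_real E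
  have : CompleteSpace E := FiniteDimensional.complete ℝ E
  obtain ⟨B, hB⟩ := hX.ac.exists_bound
  obtain ⟨B', hB'⟩ := hY.ac.exists_bound
  rw [uIcc_of_le hT] at hB hB'
  obtain ⟨K, hK⟩ := (hf.locallyLipschitzOn
    (s := Metric.closedBall 0 (max B B'))).exists_lipschitzOnWith_of_compact (isCompact_closedBall _ _)
  have hGc : ContinuousOn G (Icc 0 T) := by simpa [uIcc_of_le hT] using hG.continuousOn
  have key := ODE_solution_unique_of_mem_Icc_right (a := 0) (b := T) (K := K)
    (v := fun t y => f (y + G t)) (s := fun t => {y | y + G t ∈ Metric.closedBall 0 (max B B')})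
    (f := fun t => X t - G t) (g := fun t => Y t - G t) (by
      intro t _ y hy z hz
      simpa using hK hy hz)
    ((hX.continuousOn hT).sub hGc)
    (fun t ht => by simpa using hX.hasDerivWithinAt_sub hT hf.continuous hG hGd ht)
    (fun t ht => by simpa using Or.inl (hB t ⟨ht.1, ht.2.le⟩))
    ((hY.continuousOn hT).sub hGc)
    (fun t ht => by simpa using hY.hasDerivWithinAt_sub hT hf.continuous hG hGd ht)
    (fun t ht => by simpa using Or.inr (hB' t ⟨ht.1, ht.2.le⟩))
    (by simp [hX.init, hY.init])
  intro t ht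
  simpa using key ht

/-- A bounded, globally Lipschitz vector field has solutions on every interval `[0, T]`. -/
theorem exists_of_lipschitzWith [CompleteSpace E] {K C : NNReal} (hf : LipschitzWith K f)
    (hC : ∀ x, ‖f x‖ ≤ C) (hT : 0 ≤ T) (x₀ : E)
    {G : ℝ → E} (hG : AbsolutelyContinuousOnInterval G 0 T) (hG0 : G 0 = 0)
    (hGd : ∀ᵐ t, t ∈ Icc 0 T → HasDerivAt G (d t) t) : ∃ X, IsACSolOn f d x₀ T X := by
  have hGc : ContinuousOn G (Icc 0 T) := by simpa [uIcc_of_le hT] using hG.continuousOn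
  -- Picard–Lindelöf for `y = X - G`. As `f` is bounded by `C` everywhere, a ball of radius `C T`
  -- holds the curve on all of `[0, T]`, so `T` need not be small.
  have hP : IsPicardLindelof (fun t y => f (y + G t)) (tmin := 0) (tmax := T) ⟨0, le_rfl, hT⟩ x₀
      (C * ⟨T, hT⟩) 0 C K := by
    refine ⟨fun t _ => ?_, fun y _ => ?_, fun t _ y _ => hC _, ?_⟩
    · intro y _ z _
      simpa using hf (y + G t) (z + G t)
    · exact hf.continuous.comp_continuousOn (continuousOn_const.add hGc)
    · simp [hT]
      rfl
  obtain ⟨y, hy0, hy⟩ := hP.exists_eq_forall_mem_Icc_hasDerivWithinAt₀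
  have hyL : LipschitzOnWith C y (uIcc 0 T) := by
    rw [uIcc_of_le hT]
    exact (convex_Icc 0 T).lipschitzOnWith_of_nnnorm_hasDerivWithin_le hy fun t _ => hC _
  refine ⟨fun t => y t + G t, by simp [hG0, show y 0 = x₀ from hy0],
    hyL.absolutelyContinuousOnInterval.fun_add hG, ?_⟩
  have h0 : ∀ᵐ t : ℝ, t ≠ 0 := by simp [ae_iff, measure_singleton]
  have h1 : ∀ᵐ t : ℝ, t ≠ T := by simp [ae_iff, measure_singleton]
  filter_upwards [hGd, h0, h1] with t ht ht0 htT htm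
  exact ((hy t htm).hasDerivAt (Icc_mem_nhds (lt_of_le_of_ne htm.1 ht0.symm)
    (lt_of_le_of_ne htm.2 htT))).add (ht htm)

end IsACSolOn

/-- Coordinatewise projection onto the cube `[-M, M]^ι`. -/
def cubeProj {ι : Type*} (M : ℝ) (x : ι → ℝ) : ι → ℝ := fun i => max (-M) (min M (x i))

section

variable {ι : Type*} [Fintype ι] {M : ℝ}

theorem lipschitzWith_cubeProj : LipschitzWith 1 (cubeProj (ι := ι) M) := by
  refine LipschitzWith.of_dist_le_mul fun x y => ?_
  rw [NNReal.coe_one, one_mul, dist_pi_le_iff dist_nonneg]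
  intro i
  refine le_trans ?_ (dist_le_pi_dist x y i)
  have : LipschitzWith 1 fun r : ℝ => max (-M) (min M r) := by
    simpa using (LipschitzWith.id.const_min M).const_max (-M)
  simpa [cubeProj] using this.dist_le_mul (x i) (y i)

theorem cubeProj_mem (hM : 0 ≤ M) (x : ι → ℝ) : cubeProj M x ∈ Metric.closedBall 0 M := by
  rw [mem_closedBall_zero_iff, pi_norm_le_iff_of_nonneg hM]
  intro i
  rw [Real.norm_eq_abs, abs_le]
  exact ⟨le_max_left _ _, max_le (by linarith) (min_le_left _ _)⟩

theorem cubeProj_eq_self {x : ι → ℝ} (hx : ‖x‖ ≤ M) : cubeProj M x = x := by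
  funext i
  have := abs_le.1 ((norm_le_pi_norm x i).trans hx)
  rw [cubeProj, min_eq_right this.2, max_eq_right this.1]

/-- An a priori bound on solutions yields existence on `[0, T]`. -/
theorem IsACSolOn.exists_of_bound {f : (ι → ℝ) → ι → ℝ} {d : ℝ → ι → ℝ} {x₀ : ι → ℝ} {T B : ℝ}
    (hT : 0 ≤ T) (hf : LocallyLipschitz f)
    {G : ℝ → ι → ℝ} (hG : AbsolutelyContinuousOnInterval G 0 T) (hG0 : G 0 = 0)
    (hGd : ∀ᵐ t, t ∈ Icc 0 T → HasDerivAt G (d t) t)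
    (hB : ∀ S ∈ Icc 0 T, ∀ X, IsACSolOn f d x₀ S X → ‖X S‖ ≤ B) : ∃ X, IsACSolOn f d x₀ T X := by
  -- The `+ 1` puts the truncation radius strictly above the a priori bound; `‖x₀‖` only ensures
  -- that `M` is nonnegative.
  set M : ℝ := max B ‖x₀‖ + 1 with hM
  have hM0 : 0 ≤ M := by have := (norm_nonneg x₀).trans (le_max_right B _); linarith
  obtain ⟨K, hK⟩ := (hf.locallyLipschitzOn
    (s := Metric.closedBall 0 M)).exists_lipschitzOnWith_of_compact (isCompact_closedBall _ _)
  obtain ⟨C, hC⟩ := (isCompact_closedBall (0 : ι → ℝ) M).exists_bound_of_continuousOn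
    hf.continuous.continuousOn
  have hL : LipschitzWith (K * 1) (f ∘ cubeProj M) := by
    rw [← lipschitzOnWith_univ]
    exact hK.comp lipschitzWith_cubeProj.lipschitzOnWith fun x _ => cubeProj_mem hM0 x
  obtain ⟨X, hX⟩ := IsACSolOn.exists_of_lipschitzWith (d := d) (C := C.toNNReal) hL
    (fun x => (hC _ (cubeProj_mem hM0 x)).trans (Real.le_coe_toNNReal C)) hT x₀ hG hG0 hGd
  have hXc := hX.continuousOn hT
  have hconv : ∀ S ∈ Icc 0 T, (∀ t ∈ Ico 0 S, ‖X t‖ ≤ M) → IsACSolOn f d x₀ S X := by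
    intro S hS hle
    have hXS := hX.mono hS.1 hS.2
    refine ⟨hXS.init, hXS.ac, ?_⟩
    have h1 : ∀ᵐ t : ℝ, t ≠ S := by simp [ae_iff, measure_singleton]
    filter_upwards [hXS.ode, h1] with t ht htS htm
    simpa [cubeProj_eq_self (hle t ⟨htm.1, lt_of_le_of_ne htm.2 htS⟩)] using ht htm
  -- At the first time `S` with `‖X S‖ ≥ M`, the truncation has not yet acted, so `X` solves the
  -- original equation on `[0, S]` and `‖X S‖ ≤ B < M`.
  have hlt : ∀ t ∈ Icc 0 T, ‖X t‖ < M := by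
    by_contra! hcon
    have hcl : IsCompact (Icc 0 T ∩ (fun t => ‖X t‖) ⁻¹' Ici M) :=
      isCompact_Icc.of_isClosed_subset
        (hXc.norm.preimage_isClosed_of_isClosed isClosed_Icc isClosed_Ici) inter_subset_left
    obtain ⟨t₁, ht₁, hm₁⟩ := hcon
    obtain ⟨S, hS, hmin⟩ := hcl.exists_isLeast ⟨t₁, ht₁, hm₁⟩
    have hsol := hconv S hS.1 fun t ht => by
      by_contra! hlt
      exact absurd (hmin ⟨⟨ht.1, ht.2.le.trans hS.1.2⟩, hlt.le⟩) (not_le.2 ht.2)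
    have h1 := hB S hS.1 X hsol
    have h2 : M ≤ ‖X S‖ := hS.2
    have h3 := le_max_left B ‖x₀‖
    linarith
  exact ⟨X, hconv T ⟨hT, le_rfl⟩ fun t ht => (hlt t ⟨ht.1, ht.2.le⟩).le⟩

end

/-- Solutions on all intervals `[0, T]` glue to a solution on the half-line. -/
theorem IsACSolOn.exists_global {E : Type*} [NormedAddCommGroup E] [NormedSpace ℝ E]
    [FiniteDimensional ℝ E] {f : E → E} {d : ℝ → E} {x₀ : E}
    (hf : LocallyLipschitz f)
    {G : ℝ → E} (hG : ∀ T, 0 ≤ T → AbsolutelyContinuousOnInterval G 0 T)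
    (hGd : ∀ T, 0 ≤ T → ∀ᵐ t, t ∈ Icc 0 T → HasDerivAt G (d t) t)
    (hex : ∀ T, 0 ≤ T → ∃ X, IsACSolOn f d x₀ T X) :
    ∃ X, ∀ T, 0 ≤ T → IsACSolOn f d x₀ T X := by
  choose Y hY using fun n : ℕ => hex n n.cast_nonneg
  have heq : ∀ n m : ℕ, n ≤ m → EqOn (Y n) (Y m) (Icc 0 n) := fun n m hnm =>
    (hY n).eqOn ((hY m).mono n.cast_nonneg (Nat.cast_le.2 hnm)) n.cast_nonneg hf
      (hG n n.cast_nonneg) (hGd n n.cast_nonneg)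
  -- Uniqueness makes the choice of the interval irrelevant at nonnegative times.
  set X : ℝ → E := fun t => Y ⌈t⌉₊ t with hX
  have hXY : ∀ n : ℕ, EqOn (Y n) X (Icc 0 n) := fun n t ht =>
    (heq ⌈t⌉₊ n (Nat.ceil_le.2 ht.2) ⟨ht.1, Nat.le_ceil t⟩).symm
  refine ⟨X, fun T hT => ?_⟩
  -- Strictly beyond `T`, so that the point `T` is interior to `[0, n]`.
  obtain ⟨n, hn⟩ := exists_nat_gt T
  have hYn := (hY n).mono hT hn.le
  refine ⟨?_, hYn.ac.congr ?_, ?_⟩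
  · rw [← hXY n ⟨le_rfl, n.cast_nonneg⟩, hYn.init]
  · rw [uIcc_of_le hT]
    exact (hXY n).mono (Icc_subset_Icc_right hn.le)
  · have h0 : ∀ᵐ t : ℝ, t ≠ 0 := by simp [ae_iff, measure_singleton]
    filter_upwards [hYn.ode, h0] with t ht ht0 htm
    have hlt : t < n := htm.2.trans_lt hn
    have h1 : X =ᶠ[𝓝 t] Y n := by
      filter_upwards [Icc_mem_nhds (lt_of_le_of_ne htm.1 ht0.symm) hlt] with s hs
      exact (hXY n hs).symm
    rw [← hXY n ⟨htm.1, hlt.le⟩]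
    exact (ht htm).congr_of_eventuallyEq h1

end ODE

/-! ### Closure properties of locally Lipschitz maps. -/

section LocallyLipschitz

theorem LocallyLipschitz.mul_real {E : Type*} [PseudoEMetricSpace E] {f g : E → ℝ}
    (hf : LocallyLipschitz f) (hg : LocallyLipschitz g) : LocallyLipschitz fun x => f x * g x :=
  (ContDiff.locallyLipschitz (𝕂 := ℝ) (f := fun p : ℝ × ℝ => p.1 * p.2) (by fun_prop)).comp
    (hf.prodMk hg)

theorem LocallyLipschitz.congr {E E' : Type*} [PseudoEMetricSpace E] [PseudoEMetricSpace E']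
    {f g : E → E'} (hf : LocallyLipschitz f) (h : ∀ x, g x = f x) : LocallyLipschitz g :=
  (funext h : g = f) ▸ hf

theorem LocallyLipschitz.pi {E ι : Type*} [PseudoEMetricSpace E] [Fintype ι] {f : E → ι → ℝ}
    (hf : ∀ i, LocallyLipschitz fun x => f x i) : LocallyLipschitz f := by
  intro x
  choose K t ht hK using fun i => hf i x
  refine ⟨Finset.univ.sup K, ⋂ i, t i, Filter.iInter_mem.2 ht, fun y hy z hz => ?_⟩
  rw [edist_pi_le_iff]
  intro i
  refine (hK i (Set.mem_iInter.1 hy i) (Set.mem_iInter.1 hz i)).trans ?_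
  gcongr
  exact Finset.le_sup (Finset.mem_univ i)

end LocallyLipschitz

/-! ### Saturation and local Lipschitz continuity of the closed loop. -/

namespace GFM

theorem sat_top (y : ℝ) : sat ⊤ y = y := by simp [sat]

theorem sat_coe {r : ℝ} (hr : 0 < r) (y : ℝ) : sat (r : EReal) y = max (-r) (min r y) := by
  have h : (y : EReal) < -(r : EReal) ↔ y < -r := by exact_mod_cast Iff.rfl
  simp only [sat, h, EReal.coe_lt_coe_iff, EReal.toReal_coe]
  grind

theorem sat_eq_self_or_eq_clamp {S : EReal} (hS : 0 < S) :
    (∀ y, sat S y = y) ∨ ∃ r : ℝ, 0 < r ∧ ∀ y, sat S y = max (-r) (min r y) := by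
  induction S with
  | bot => simp at hS
  | top => exact Or.inl sat_top
  | coe r =>
    have hr : 0 < r := by exact_mod_cast hS
    exact Or.inr ⟨r, hr, sat_coe hr⟩

theorem lipschitzWith_sat {S : EReal} (hS : 0 < S) : LipschitzWith 1 (sat S) := by
  rcases sat_eq_self_or_eq_clamp hS with h | ⟨r, -, h⟩
  · rw [show sat S = id from funext h]
    exact LipschitzWith.id
  · rw [show sat S = fun y => max (-r) (min r y) from funext h]
    simpa using (LipschitzWith.id.const_min r).const_max (-r)

/-- Serves the active-power filter, whose level may be `⊤`: its input is then bounded only through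
the power itself. -/
theorem abs_sat_le_abs {S : EReal} (hS : 0 < S) (y : ℝ) : |sat S y| ≤ |y| := by
  rcases sat_eq_self_or_eq_clamp hS with h | ⟨r, hr, h⟩
  · rw [h]
  · rw [h]; grind

theorem abs_sat_coe_le {r : ℝ} (hr : 0 < r) (y : ℝ) : |sat (r : EReal) y| ≤ r := by
  rw [sat_coe hr]; grind

variable {F : FilterParams} {N : NetworkParams} {D : DesignParams}

theorem locallyLipschitz_Wd : LocallyLipschitz (Wd F D) := by
  have : ContDiff ℝ 1 (Wd F D) := by
    unfold Wd itdRef freq vcdRef; fun_prop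
  exact this.locallyLipschitz

theorem locallyLipschitz_Wq : LocallyLipschitz (Wq F D) := by
  have : ContDiff ℝ 1 (Wq F D) := by
    unfold Wq itqRef freq; fun_prop
  exact this.locallyLipschitz

theorem locallyLipschitz_sat_reactivePower {S : EReal} (hS : 0 < S) :
    LocallyLipschitz fun x => sat S (reactivePower x) := by
  have : ContDiff ℝ 1 reactivePower := by unfold reactivePower; fun_prop
  exact (lipschitzWith_sat hS).locallyLipschitz.comp this.locallyLipschitz

theorem locallyLipschitz_sat_activePower {S : EReal} (hS : 0 < S) :
    LocallyLipschitz fun x => sat S (activePower x) := by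
  have : ContDiff ℝ 1 activePower := by unfold activePower; fun_prop
  exact (lipschitzWith_sat hS).locallyLipschitz.comp this.locallyLipschitz

theorem locallyLipschitz_vtd (hQ : 0 < D.Qbar) : LocallyLipschitz (vtd F D) := by
  have hs := locallyLipschitz_sat_reactivePower (S := (D.Qbar : EReal)) (by exact_mod_cast hQ)
  have hu : ContDiff ℝ 1 (ud F D) := by unfold ud itdRef freq vcdRef; fun_prop
  -- The saturation is the only term that is not `C¹`, so it is split off.
  have h1 : ContDiff ℝ 1 fun x : State => F.Lf / F.ωb *
      (-2 * F.ωb * freq D x * (x .itq - x .igq) + F.ωb * F.Rf / F.Lf * x .itd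
      + F.ωb * (1 / F.Lf + freq D x ^ 2 * F.Cf) * x .vcd + F.Cf * D.KP * x .p2 * x .vcq
      - D.KVC * (x .itd - itdRef F D x)
      + F.Cf * D.KVC ^ 2 / F.ωb * (x .vcd - vcdRef D x)
      + 2 * D.ξq * D.ωqc * D.KQ * F.Cf / F.ωb * x .q2
      + D.ωqc ^ 2 * D.KQ * F.Cf / F.ωb * x .q1 + ud F D x) := by
    unfold itdRef freq vcdRef; fun_prop
  have h2 := h1.locallyLipschitz.sub
    (((LocallyLipschitz.const (F.Lf / F.ωb * (D.ωqc ^ 2 * D.KQ * F.Cf / F.ωb))).mul_real hs))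
  refine h2.congr fun x => ?_
  unfold vtd; ring

theorem contDiff_vtq : ContDiff ℝ 1 (vtq F D) := by
  unfold vtq uq itqRef freq; fun_prop

theorem locallyLipschitz_closedLoop (hQ : 0 < D.Qbar) (hP : 0 < D.Pbar) :
    LocallyLipschitz fun x => closedLoop F N D x 0 0 := by
  have hsq := locallyLipschitz_sat_reactivePower (S := (D.Qbar : EReal)) (by exact_mod_cast hQ)
  have hsp := locallyLipschitz_sat_activePower hP
  have hvd := locallyLipschitz_vtd (F := F) hQ
  have hvq : ContDiff ℝ 1 (vtq F D) := contDiff_vtq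
  have smooth : ∀ {g : State → ℝ}, ContDiff ℝ 1 g → LocallyLipschitz g :=
    fun h => h.locallyLipschitz
  refine LocallyLipschitz.pi fun i => ?_
  cases i <;> simp only [closedLoop]
  case itd =>
    have h1 : ContDiff ℝ 1 fun x : State => F.ωb * freq D x * x .itq - F.ωb / F.Lf * x .vcd
      - F.ωb * F.Rf / F.Lf * x .itd := by unfold freq; fun_prop
    exact LocallyLipschitz.congr ((smooth h1).add
      ((LocallyLipschitz.const (F.ωb / F.Lf)).mul_real hvd)) fun x => by ring
  case q2 =>
    have h1 : ContDiff ℝ 1 fun x : State => -2 * D.ξq * D.ωqc * x .q2 - D.ωqc ^ 2 * x .q1 := by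
      fun_prop
    exact LocallyLipschitz.congr ((smooth h1).add
      ((LocallyLipschitz.const (D.ωqc ^ 2)).mul_real hsq)) fun x => by ring
  case p2 =>
    have h1 : ContDiff ℝ 1 fun x : State => -2 * D.ξp * D.ωpc * x .p2 - D.ωpc ^ 2 * x .p1 := by
      fun_prop
    exact LocallyLipschitz.congr ((smooth h1).add
      ((LocallyLipschitz.const (D.ωpc ^ 2)).mul_real hsp)) fun x => by ring
  case zd =>
    have h1 : ContDiff ℝ 1 fun x : State => D.Γd * Real.exp (-x .zd) := by fun_prop
    exact (smooth h1).mul_real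
      ((locallyLipschitz_Wd.sub (LocallyLipschitz.const D.ε)).max_const 0)
  case zq =>
    have h1 : ContDiff ℝ 1 fun x : State => D.Γq * Real.exp (-x .zq) := by fun_prop
    exact (smooth h1).mul_real
      ((locallyLipschitz_Wq.sub (LocallyLipschitz.const D.ε)).max_const 0)
  all_goals
    refine smooth ?_
    try unfold freq
    fun_prop

/-- The grid voltage acts additively through constant vectors; this is what allows it to be removed
by a primitive. -/
theorem closedLoop_eq_add_smul (x : State) (vd vq : ℝ) :
    closedLoop F N D x vd vq = closedLoop F N D x 0 0 +
      (vd • Pi.single Coord.igd (-(F.ωb / N.L)) + vq • Pi.single Coord.igq (-(F.ωb / N.L))) := by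
  funext i
  cases i <;> simp [closedLoop] <;> ring

/-! ### Backstepping error dynamics and the dissipation inequalities. -/

section Energy

variable {X : ℝ → State} {t vd vq : ℝ}

/-- `itdRef` is the value of `itd` that would make the voltage error decay at rate `KVC`; its `q2`
term compensates the motion of the droop reference. -/
theorem hasDerivAt_vcd_error (hωb : F.ωb ≠ 0) (hCf : F.Cf ≠ 0)
    (hX : HasDerivAt X (closedLoop F N D (X t) vd vq) t) :
    HasDerivAt (fun s => X s .vcd - vcdRef D (X s))
      (F.ωb / F.Cf * (X t .itd - itdRef F D (X t)) - D.KVC * (X t .vcd - vcdRef D (X t))) t := by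
  have h := hasDerivAt_pi.1 hX
  have h1 := (h .vcd).sub ((((h .q1).const_sub D.Q0).const_mul D.KQ).const_add D.V0)
  convert! h1 using 1
  simp only [closedLoop, itdRef]
  field_simp
  ring

/-- Differentiating `itdRef` brings in the derivative of `igd`, the only source of `L`, `R` and the
grid voltage. All other terms are known and cancelled by `vtd`. -/
theorem hasDerivAt_itd_error (hωb : F.ωb ≠ 0) (hCf : F.Cf ≠ 0) (hLf : F.Lf ≠ 0)
    (hX : HasDerivAt X (closedLoop F N D (X t) vd vq) t) :
    HasDerivAt (fun s => X s .itd - itdRef F D (X s))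
      (ud F D (X t) + F.ωb / N.L * (vd + N.R * X t .igd - X t .vcd)) t := by
  have h := hasDerivAt_pi.1 hX
  have hω := (((h .p1).const_sub D.P0).const_mul D.KP).const_add D.ω0
  have h1 := (h .itd).sub ((((h .igd).sub ((hω.const_mul F.Cf).mul (h .vcq))).sub
    ((h .q2).const_mul (F.Cf * D.KQ / F.ωb))).sub
    ((hasDerivAt_vcd_error hωb hCf hX).const_mul (F.Cf * D.KVC / F.ωb)))
  convert! h1 using 1
  simp only [closedLoop, vtd]
  -- The cancellation holds for arbitrary values of these four quantities, which reduces it to a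
  -- rational identity.
  generalize ud F D (X t) = u
  generalize sat D.Qbar (reactivePower (X t)) = s
  generalize vcdRef D (X t) = v
  generalize itdRef F D (X t) = i
  simp only [freq, div_eq_mul_inv, one_mul]
  field_simp
  ring

theorem hasDerivAt_vcq (hωb : F.ωb ≠ 0) (hCf : F.Cf ≠ 0)
    (hX : HasDerivAt X (closedLoop F N D (X t) vd vq) t) :
    HasDerivAt (fun s => X s .vcq)
      (F.ωb / F.Cf * (X t .itq - itqRef F D (X t)) - D.KVC * X t .vcq) t := by
  have h := hasDerivAt_pi.1 hX
  convert! h .vcq using 1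
  simp only [closedLoop, itqRef]
  field_simp
  ring

theorem hasDerivAt_itq_error (hωb : F.ωb ≠ 0) (hCf : F.Cf ≠ 0) (hLf : F.Lf ≠ 0)
    (hX : HasDerivAt X (closedLoop F N D (X t) vd vq) t) :
    HasDerivAt (fun s => X s .itq - itqRef F D (X s))
      (uq F D (X t) + F.ωb / N.L * (vq + N.R * X t .igq - X t .vcq)) t := by
  have h := hasDerivAt_pi.1 hX
  have hω := (((h .p1).const_sub D.P0).const_mul D.KP).const_add D.ω0
  have h1 := (h .itq).sub ((((h .igq).add ((hω.const_mul F.Cf).mul (h .vcd)))).sub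
    ((hasDerivAt_vcq hωb hCf hX).const_mul (F.Cf * D.KVC / F.ωb)))
  convert! h1 using 1
  simp only [closedLoop, vtq]
  generalize uq F D (X t) = u
  generalize itqRef F D (X t) = i
  simp only [freq, div_eq_mul_inv, one_mul]
  field_simp
  ring

/-- Young's inequality by completing the square: `p b² - s b + r` has nonpositive discriminant in
`b`. -/
theorem mul_le_of_sq_le {p r s b : ℝ} (hp : 0 < p) (h : s ^ 2 ≤ 4 * p * r) :
    b * s ≤ p * b ^ 2 + r := by
  have : 0 ≤ 4 * p * (p * b ^ 2 + r - b * s) := by nlinarith [sq_nonneg (2 * p * b - s)]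
  have := nonneg_of_mul_nonneg_right this (by positivity)
  linarith

/-- The nonlinear damping term dominates the unmatched disturbance. -/
theorem damping_estimate {ωb L R μ KVC KCC a b c e i v w m k : ℝ} (hωb : 0 < ωb) (hL : 0 < L)
    (hμ : 0 < μ) (hk : k = min KVC KCC) (he : 0 < e) (hw : |w| ≤ m) :
    a * (c * b - KVC * a)
      + b * ((-(KCC + (1 + e) * ωb ^ 2 / (4 * μ) * (1 + i ^ 2 + v ^ 2)) * b - c * a)
        + ωb / L * (w + R * i - v))
      ≤ -(2 * k) * (1 / 2 * a ^ 2 + 1 / 2 * b ^ 2) + μ * (1 + R ^ 2 + m ^ 2) / L ^ 2 / (1 + e) := by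
  have hk1 : k ≤ KVC := hk ▸ min_le_left _ _
  have hk2 : k ≤ KCC := hk ▸ min_le_right _ _
  have hwm : w ^ 2 ≤ m ^ 2 := sq_le_sq.2 (hw.trans (le_abs_self m))
  -- Cauchy–Schwarz for `(1, i, v)` and `(w, R, -1)`; the squares supplied below are those of
  -- Lagrange's identity.
  have hcs : (w + R * i - v) ^ 2 ≤ (1 + i ^ 2 + v ^ 2) * (1 + R ^ 2 + m ^ 2) := by
    have h1 : (w + R * i - v) ^ 2 ≤ (1 + i ^ 2 + v ^ 2) * (1 + R ^ 2 + w ^ 2) := by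
      nlinarith [sq_nonneg (w * i - R), sq_nonneg (w * v + 1), sq_nonneg (R * v + i)]
    refine h1.trans ?_
    gcongr
  -- `p` is the damping gain and `r` the residual. In `4 p r` the factors `μ` and `1 + e` cancel,
  -- leaving exactly the Cauchy–Schwarz bound times `(ωb / L)²`.
  have key := mul_le_of_sq_le (b := b) (s := ωb / L * (w + R * i - v))
    (p := (1 + e) * ωb ^ 2 / (4 * μ) * (1 + i ^ 2 + v ^ 2))
    (r := μ * (1 + R ^ 2 + m ^ 2) / L ^ 2 / (1 + e)) (by positivity) (by
      have : 4 * ((1 + e) * ωb ^ 2 / (4 * μ) * (1 + i ^ 2 + v ^ 2)) *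
          (μ * (1 + R ^ 2 + m ^ 2) / L ^ 2 / (1 + e))
          = (ωb / L) ^ 2 * ((1 + i ^ 2 + v ^ 2) * (1 + R ^ 2 + m ^ 2)) := by
        field_simp
      rw [this, mul_pow]
      gcongr)
  have h1 := mul_le_mul_of_nonneg_right hk1 (sq_nonneg a)
  have h2 := mul_le_mul_of_nonneg_right hk2 (sq_nonneg b)
  linarith

/-- The divisor `1 + exp zd` is kept: it makes the disturbance fade as the gain grows. -/
theorem exists_hasDerivAt_Wd_le (hωb : 0 < F.ωb) (hCf : 0 < F.Cf) (hLf : 0 < F.Lf) (hL : 0 < N.L)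
    (hμ : 0 < D.μd) {k m : ℝ} (hk : k = min D.KVC D.KCC) (hv : |vd| ≤ m)
    (hX : HasDerivAt X (closedLoop F N D (X t) vd vq) t) :
    ∃ W', HasDerivAt (fun s => Wd F D (X s)) W' t ∧ W' ≤ -(2 * k) * Wd F D (X t)
      + D.μd * (1 + N.R ^ 2 + m ^ 2) / N.L ^ 2 / (1 + Real.exp (X t .zd)) := by
  have ha := hasDerivAt_vcd_error hωb.ne' hCf.ne' hX
  have hb := hasDerivAt_itd_error hωb.ne' hCf.ne' hLf.ne' hX
  refine ⟨_, ((ha.pow 2).const_mul (1 / 2)).add ((hb.pow 2).const_mul (1 / 2)), ?_⟩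
  refine le_trans (le_of_eq ?_) (damping_estimate (a := X t .vcd - vcdRef D (X t))
    (b := X t .itd - itdRef F D (X t)) (c := F.ωb / F.Cf) (i := X t .igd) (v := X t .vcd)
    hωb hL hμ hk (Real.exp_pos _) hv)
  rw [ud]
  push_cast
  ring

theorem exists_hasDerivAt_Wq_le (hωb : 0 < F.ωb) (hCf : 0 < F.Cf) (hLf : 0 < F.Lf) (hL : 0 < N.L)
    (hμ : 0 < D.μq) {k m : ℝ} (hk : k = min D.KVC D.KCC) (hv : |vq| ≤ m)
    (hX : HasDerivAt X (closedLoop F N D (X t) vd vq) t) :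
    ∃ W', HasDerivAt (fun s => Wq F D (X s)) W' t ∧ W' ≤ -(2 * k) * Wq F D (X t)
      + D.μq * (1 + N.R ^ 2 + m ^ 2) / N.L ^ 2 / (1 + Real.exp (X t .zq)) := by
  have ha := hasDerivAt_vcq hωb.ne' hCf.ne' hX
  have hb := hasDerivAt_itq_error hωb.ne' hCf.ne' hLf.ne' hX
  refine ⟨_, ((ha.pow 2).const_mul (1 / 2)).add ((hb.pow 2).const_mul (1 / 2)), ?_⟩
  refine le_trans (le_of_eq ?_) (damping_estimate (a := X t .vcq)
    (b := X t .itq - itqRef F D (X t)) (c := F.ωb / F.Cf) (i := X t .igq) (v := X t .vcq)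
    hωb hL hμ hk (Real.exp_pos _) hv)
  rw [uq]
  push_cast
  ring

end Energy

end GFM

/-! ### Bounds on reachable states from differential inequalities. -/

section Reachable

open Set

/-- States reached within time `T` by absolutely continuous solutions of `X' = f X + d` that start
at `x₀`. -/
def reachable {E : Type*} [NormedAddCommGroup E] [NormedSpace ℝ E] (f : E → E) (d : ℝ → E)
    (x₀ : E) (T : ℝ) : Set E :=
  {y | ∃ S ∈ Icc 0 T, ∃ X, IsACSolOn f d x₀ S X ∧ X S = y}

variable {E : Type*} [NormedAddCommGroup E] [NormedSpace ℝ E] {f : E → E} {d : ℝ → E} {x₀ : E}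
  {T m c : ℝ} {V : E → ℝ}

theorem IsACSolOn.mem_reachable {S t : ℝ} {X : ℝ → E} (h : IsACSolOn f d x₀ S X)
    (hS : S ≤ T) (ht : t ∈ Icc 0 S) : X t ∈ reachable f d x₀ T :=
  ⟨t, ⟨ht.1, ht.2.trans hS⟩, X, h.mono ht.1 ht.2, rfl⟩

/-- The derivative bound is required only at reachable states, so a bound proved for some
coordinates may be used to bound others. -/
theorem reachable_le_of_deriv_le (hV : LocallyLipschitz V) (hm : 0 ≤ m)
    (h : ∀ᵐ t, ∀ X : ℝ → E, 0 ≤ t → X t ∈ reachable f d x₀ T → HasDerivAt X (f (X t) + d t) t →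
      ∃ v', HasDerivAt (fun s => V (X s)) v' t ∧ v' ≤ m) :
    ∀ y ∈ reachable f d x₀ T, V y ≤ V x₀ + m * T := by
  rintro y ⟨S, hS, X, hX, rfl⟩
  have h1 := (hV.comp_absolutelyContinuousOnInterval hX.ac).le_add_of_ae_deriv_le (m := m) hS.1 (by
    filter_upwards [h, hX.ode] with t ht ht' htm
    exact ht X htm.1 (hX.mem_reachable hS.2 htm) (ht' htm))
  simp only [Function.comp_apply, hX.init] at h1
  nlinarith [hS.2]

theorem exists_reachable_le_of_deriv_le_mul_add (hV : LocallyLipschitz V) (hV0 : ∀ x, 0 ≤ V x)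
    (hm : 0 ≤ m) (hc : 0 < c)
    (h : ∀ᵐ t, ∀ X : ℝ → E, 0 ≤ t → X t ∈ reachable f d x₀ T → HasDerivAt X (f (X t) + d t) t →
      ∃ v', HasDerivAt (fun s => V (X s)) v' t ∧ v' ≤ c * V (X t) + m) :
    ∃ B, ∀ y ∈ reachable f d x₀ T, V y ≤ B := by
  refine ⟨Real.exp (c * T) * (V x₀ + m / c), ?_⟩
  rintro y ⟨S, hS, X, hX, rfl⟩
  -- Grönwall with the negative rate `-c`, turning decay into exponential growth.
  have h1 := (hV.comp_absolutelyContinuousOnInterval hX.ac).gronwall_le (m := m) (c := -c) hS.1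
    (neg_ne_zero.2 hc.ne') (by
    filter_upwards [h, hX.ode] with t ht ht' htm
    simpa using! ht X htm.1 (hX.mem_reachable hS.2 htm) (ht' htm))
  simp only [Function.comp_apply, hX.init, neg_neg, sub_zero, div_neg, sub_neg_eq_add] at h1
  have h2 : 0 ≤ m / c := by positivity
  have h3 : Real.exp (c * S) * (V x₀ + m / c) ≤ Real.exp (c * T) * (V x₀ + m / c) := by
    have := hV0 x₀
    have := hS.2
    gcongr
  linarith

/-- A real function is bounded on a set. -/
def BddOn {α : Type*} (s : Set α) (g : α → ℝ) : Prop := ∃ B, ∀ y ∈ s, |g y| ≤ B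

namespace BddOn

variable {α : Type*} {s : Set α} {g h : α → ℝ}

theorem const (c : ℝ) : BddOn s fun _ => c := ⟨|c|, fun _ _ => le_rfl⟩

theorem add (hg : BddOn s g) (hh : BddOn s h) : BddOn s fun y => g y + h y := by
  obtain ⟨B, hB⟩ := hg
  obtain ⟨B', hB'⟩ := hh
  exact ⟨B + B', fun y hy => (abs_add_le _ _).trans (add_le_add (hB y hy) (hB' y hy))⟩

theorem mul (hg : BddOn s g) (hh : BddOn s h) : BddOn s fun y => g y * h y := by
  obtain ⟨B, hB⟩ := hg
  obtain ⟨B', hB'⟩ := hh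
  refine ⟨B * B', fun y hy => ?_⟩
  rw [abs_mul]
  exact mul_le_mul (hB y hy) (hB' y hy) (abs_nonneg _) ((abs_nonneg _).trans (hB y hy))

theorem sub (hg : BddOn s g) (hh : BddOn s h) : BddOn s fun y => g y - h y := by
  simpa [sub_eq_add_neg] using hg.add ((const (-1)).mul hh)

theorem of_sq_le {V : α → ℝ} (hV : ∃ B, ∀ y ∈ s, V y ≤ B) (hg : ∀ y, g y ^ 2 ≤ 2 * V y) :
    BddOn s g := by
  obtain ⟨B, hB⟩ := hV
  -- A crude constant from `2 |g| ≤ 1 + g²`, which avoids square roots.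
  refine ⟨1 + 2 * B, fun y hy => ?_⟩
  have h1 := hg y
  have h2 := hB y hy
  have h3 := sq_abs (g y)
  nlinarith [sq_nonneg (|g y| - 1)]

theorem exists_nonneg (hg : BddOn s g) : ∃ B, 0 ≤ B ∧ ∀ y ∈ s, |g y| ≤ B := by
  obtain ⟨B, hB⟩ := hg
  exact ⟨max B 0, le_max_right _ _, fun y hy => (hB y hy).trans (le_max_left _ _)⟩

end BddOn

end Reachable

/-! ### A priori bounds for the closed loop on bounded time intervals. -/

namespace GFM

open Set

variable {F : FilterParams} {N : NetworkParams} {D : DesignParams}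

/-- The closed loop with the grid voltage set to zero. -/
noncomputable def unforcedLoop (F : FilterParams) (N : NetworkParams) (D : DesignParams)
    (x : State) : State :=
  closedLoop F N D x 0 0

/-- The contribution of the grid voltage to the closed loop. -/
noncomputable def gridForcing (F : FilterParams) (N : NetworkParams) (vgd vgq : ℝ → ℝ)
    (t : ℝ) : State :=
  vgd t • Pi.single Coord.igd (-(F.ωb / N.L)) + vgq t • Pi.single Coord.igq (-(F.ωb / N.L))

theorem unforcedLoop_add_gridForcing (x : State) (vgd vgq : ℝ → ℝ) (t : ℝ) :
    unforcedLoop F N D x + gridForcing F N vgd vgq t = closedLoop F N D x (vgd t) (vgq t) :=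
  (closedLoop_eq_add_smul x _ _).symm

theorem Wd_nonneg (x : State) : 0 ≤ Wd F D x := by unfold Wd; positivity

theorem Wq_nonneg (x : State) : 0 ≤ Wq F D x := by unfold Wq; positivity

/-- Energy estimate for a second-order low-pass filter driven by a bounded input. -/
theorem filter_energy_le {x y s ξ w S : ℝ} (hξ : 0 < ξ) (hw : 0 < w) (hs : |s| ≤ S) :
    2 * x * y + 2 * y * (-2 * ξ * w * y - w ^ 2 * (x - s))
      ≤ (1 + 2 * w ^ 2) * (x ^ 2 + y ^ 2) + w ^ 2 * S ^ 2 := by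
  have h1 : s ^ 2 ≤ S ^ 2 := sq_le_sq.2 (hs.trans (le_abs_self S))
  have h2 := mul_le_mul_of_nonneg_left h1 (sq_nonneg w)
  have h3 : 0 ≤ ξ * w * y ^ 2 := by positivity
  nlinarith [mul_nonneg (sq_nonneg w) (sq_nonneg (x + y)), sq_nonneg (x - y),
    mul_nonneg (sq_nonneg w) (sq_nonneg (y - s)), mul_nonneg (sq_nonneg w) (sq_nonneg x)]

/-- The rotation terms cancel and resistance only dissipates. No bound on the frequency `ω` is
needed, which matters because it is bounded only after the currents. -/
theorem line_energy_le {i j p q ωb ω L R B C : ℝ} (hωb : 0 < ωb) (hL : 0 < L) (hR : 0 < R)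
    (hp : |p| ≤ B) (hq : |q| ≤ C) :
    2 * i * (ωb * ω * j + ωb / L * p - ωb * R / L * i)
      + 2 * j * (-ωb * ω * i + ωb / L * q - ωb * R / L * j)
      ≤ ωb / L * (i ^ 2 + j ^ 2) + ωb / L * (B ^ 2 + C ^ 2) := by
  have hpB : p ^ 2 ≤ B ^ 2 := sq_le_sq.2 (hp.trans (le_abs_self B))
  have hqC : q ^ 2 ≤ C ^ 2 := sq_le_sq.2 (hq.trans (le_abs_self C))
  have h1 : 0 ≤ ωb * R / L * (i ^ 2 + j ^ 2) := by positivity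
  have h2 : 0 < ωb / L := by positivity
  have h3 := mul_nonneg h2.le (add_nonneg (sq_nonneg (i - p)) (sq_nonneg (j - q)))
  have h4 := mul_le_mul_of_nonneg_left (add_le_add hpB hqC) h2.le
  linarith

/-- On a bounded time interval all solutions of the closed loop stay in a common bounded set. -/
theorem exists_bound_reachable (hωb : 0 < F.ωb) (hCf : 0 < F.Cf) (hLf : 0 < F.Lf)
    (hL : 0 < N.L) (hR : 0 < N.R) (hKVC : 0 < D.KVC) (hKCC : 0 < D.KCC) (hμd : 0 < D.μd)
    (hμq : 0 < D.μq) (hΓd : 0 < D.Γd) (hΓq : 0 < D.Γq)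
    (hωpc : 0 < D.ωpc) (hωqc : 0 < D.ωqc) (hξp : 0 < D.ξp) (hξq : 0 < D.ξq)
    (hQbar : 0 < D.Qbar) (hPbar : 0 < D.Pbar) {vgd vgq : ℝ → ℝ} {md mq : ℝ}
    (hvd : ∀ᵐ t, 0 ≤ t → |vgd t| ≤ md) (hvq : ∀ᵐ t, 0 ≤ t → |vgq t| ≤ mq)
    (x₀ : State) (T : ℝ) :
    ∃ B, ∀ y ∈ reachable (unforcedLoop F N D) (gridForcing F N vgd vgq) x₀ T, ‖y‖ ≤ B := by
  set R := reachable (unforcedLoop F N D) (gridForcing F N vgd vgq) x₀ T with hRdef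
  have smooth : ∀ {g : State → ℝ}, ContDiff ℝ 1 g → LocallyLipschitz g :=
    fun h => h.locallyLipschitz
  have hk0 : 0 ≤ min D.KVC D.KCC := (lt_min hKVC hKCC).le
  -- The bounds form a cascade: storage functions, reactive filter (input at most `Qbar`), PCC
  -- voltages, grid currents, active filter, frequency, terminal currents, adaptive gains.
  have hWd : ∃ B, ∀ y ∈ R, Wd F D y ≤ B := by
    refine ⟨_, reachable_le_of_deriv_le (m := D.μd * (1 + N.R ^ 2 + md ^ 2) / N.L ^ 2)
      locallyLipschitz_Wd (by positivity) ?_⟩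
    filter_upwards [hvd] with t htd X ht _ hX
    rw [unforcedLoop_add_gridForcing] at hX
    obtain ⟨W', h1, h2⟩ := exists_hasDerivAt_Wd_le hωb hCf hLf hL hμd rfl (htd ht) hX
    refine ⟨W', h1, h2.trans ?_⟩
    have h3 := div_le_self (a := D.μd * (1 + N.R ^ 2 + md ^ 2) / N.L ^ 2) (by positivity)
      (show 1 ≤ 1 + Real.exp (X t .zd) by linarith [Real.exp_pos (X t .zd)])
    have h4 := mul_nonneg hk0 (Wd_nonneg (F := F) (D := D) (X t))
    linarith
  have hWq : ∃ B, ∀ y ∈ R, Wq F D y ≤ B := by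
    refine ⟨_, reachable_le_of_deriv_le (m := D.μq * (1 + N.R ^ 2 + mq ^ 2) / N.L ^ 2)
      locallyLipschitz_Wq (by positivity) ?_⟩
    filter_upwards [hvq] with t htd X ht _ hX
    rw [unforcedLoop_add_gridForcing] at hX
    obtain ⟨W', h1, h2⟩ := exists_hasDerivAt_Wq_le hωb hCf hLf hL hμq rfl (htd ht) hX
    refine ⟨W', h1, h2.trans ?_⟩
    have h3 := div_le_self (a := D.μq * (1 + N.R ^ 2 + mq ^ 2) / N.L ^ 2) (by positivity)
      (show 1 ≤ 1 + Real.exp (X t .zq) by linarith [Real.exp_pos (X t .zq)])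
    have h4 := mul_nonneg hk0 (Wq_nonneg (F := F) (D := D) (X t))
    linarith
  have hed : BddOn R fun y => y .vcd - vcdRef D y :=
    .of_sq_le hWd fun y => by unfold Wd; nlinarith [sq_nonneg (y .itd - itdRef F D y)]
  have hid : BddOn R fun y => y .itd - itdRef F D y :=
    .of_sq_le hWd fun y => by unfold Wd; nlinarith [sq_nonneg (y .vcd - vcdRef D y)]
  have hvcq : BddOn R fun y => y .vcq :=
    .of_sq_le hWq fun y => by unfold Wq; nlinarith [sq_nonneg (y .itq - itqRef F D y)]
  have hiq : BddOn R fun y => y .itq - itqRef F D y :=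
    .of_sq_le hWq fun y => by unfold Wq; nlinarith [sq_nonneg (y .vcq)]
  have hq : ∃ B, ∀ y ∈ R, y .q1 ^ 2 + y .q2 ^ 2 ≤ B := by
    refine exists_reachable_le_of_deriv_le_mul_add (V := fun y : State => y .q1 ^ 2 + y .q2 ^ 2)
      (c := 1 + 2 * D.ωqc ^ 2) (m := D.ωqc ^ 2 * D.Qbar ^ 2) (smooth (by fun_prop))
      (fun y => by positivity) (by positivity) (by positivity) (ae_of_all _ fun t X _ _ hX => ?_)
    rw [unforcedLoop_add_gridForcing] at hX
    have h := hasDerivAt_pi.1 hX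
    refine ⟨_, ((h .q1).pow 2).add ((h .q2).pow 2), ?_⟩
    refine le_trans (le_of_eq ?_) (filter_energy_le hξq hωqc
      (abs_sat_coe_le hQbar (reactivePower (X t))))
    simp only [closedLoop]
    push_cast
    ring
  have hq1 : BddOn R fun y => y .q1 :=
    .of_sq_le hq fun y => by nlinarith [sq_nonneg (y .q1), sq_nonneg (y .q2)]
  have hq2 : BddOn R fun y => y .q2 :=
    .of_sq_le hq fun y => by nlinarith [sq_nonneg (y .q1), sq_nonneg (y .q2)]
  have hvcd : BddOn R fun y => y .vcd := by
    have := hed.add ((BddOn.const D.V0).add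
      ((BddOn.const D.KQ).mul ((BddOn.const D.Q0).sub hq1)))
    simpa [vcdRef] using this
  have hi : ∃ B, ∀ y ∈ R, y .igd ^ 2 + y .igq ^ 2 ≤ B := by
    obtain ⟨B, hB⟩ := hvcd
    obtain ⟨C, hC⟩ := hvcq
    refine exists_reachable_le_of_deriv_le_mul_add (V := fun y : State => y .igd ^ 2 + y .igq ^ 2)
      (c := F.ωb / N.L) (m := F.ωb / N.L * ((B + md) ^ 2 + (C + mq) ^ 2)) (smooth (by fun_prop))
      (fun y => by positivity) (by positivity) (by positivity) ?_
    filter_upwards [hvd, hvq] with t htd htq X ht hXR hX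
    rw [unforcedLoop_add_gridForcing] at hX
    have h := hasDerivAt_pi.1 hX
    refine ⟨_, ((h .igd).pow 2).add ((h .igq).pow 2), ?_⟩
    refine le_trans (le_of_eq ?_) (line_energy_le (ω := freq D (X t)) (p := X t .vcd - vgd t)
      (q := X t .vcq - vgq t) hωb hL hR
      ((abs_sub _ _).trans (add_le_add (hB _ hXR) (htd ht)))
      ((abs_sub _ _).trans (add_le_add (hC _ hXR) (htq ht))))
    simp only [closedLoop]
    push_cast
    ring
  have higd : BddOn R fun y => y .igd :=
    .of_sq_le hi fun y => by nlinarith [sq_nonneg (y .igd), sq_nonneg (y .igq)]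
  have higq : BddOn R fun y => y .igq :=
    .of_sq_le hi fun y => by nlinarith [sq_nonneg (y .igd), sq_nonneg (y .igq)]
  have hp : ∃ B, ∀ y ∈ R, y .p1 ^ 2 + y .p2 ^ 2 ≤ B := by
    obtain ⟨S, hS⟩ : BddOn R activePower := (hvcd.mul higd).add (hvcq.mul higq)
    refine exists_reachable_le_of_deriv_le_mul_add (V := fun y : State => y .p1 ^ 2 + y .p2 ^ 2)
      (c := 1 + 2 * D.ωpc ^ 2) (m := D.ωpc ^ 2 * S ^ 2) (smooth (by fun_prop))
      (fun y => by positivity) (by positivity) (by positivity)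
      (ae_of_all _ fun t X _ hXR hX => ?_)
    rw [unforcedLoop_add_gridForcing] at hX
    have h := hasDerivAt_pi.1 hX
    refine ⟨_, ((h .p1).pow 2).add ((h .p2).pow 2), ?_⟩
    refine le_trans (le_of_eq ?_) (filter_energy_le hξp hωpc
      ((abs_sat_le_abs hPbar (activePower (X t))).trans (hS _ hXR)))
    simp only [closedLoop]
    push_cast
    ring
  have hp1 : BddOn R fun y => y .p1 :=
    .of_sq_le hp fun y => by nlinarith [sq_nonneg (y .p1), sq_nonneg (y .p2)]
  have hp2 : BddOn R fun y => y .p2 :=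
    .of_sq_le hp fun y => by nlinarith [sq_nonneg (y .p1), sq_nonneg (y .p2)]
  have hfreq : BddOn R (freq D) :=
    (BddOn.const D.ω0).add ((BddOn.const D.KP).mul ((BddOn.const D.P0).sub hp1))
  have hitd : BddOn R fun y => y .itd := by
    have href : BddOn R (itdRef F D) :=
      ((higd.sub (((BddOn.const F.Cf).mul hfreq).mul hvcq)).sub ((BddOn.const _).mul hq2)).sub
        ((BddOn.const _).mul hed)
    simpa using hid.add href
  have hitq : BddOn R fun y => y .itq := by
    have href : BddOn R (itqRef F D) :=
      (higq.add (((BddOn.const F.Cf).mul hfreq).mul hvcd)).sub ((BddOn.const _).mul hvcq)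
    simpa using hiq.add href
  have adapt : ∀ (c : Coord) (Γ : ℝ) (W : State → ℝ), 0 < Γ → (∃ B, ∀ y ∈ R, W y ≤ B) →
      (∀ x vd vq, closedLoop F N D x vd vq c = Γ * Real.exp (-x c) * max (W x - D.ε) 0) →
      BddOn R fun y => y c := by
    intro c Γ W hΓ ⟨B, hB⟩ hc
    -- The gain never decreases, so `exp (-z)` stays below its initial value, which in turn limits
    -- the growth rate of the gain.
    have hlow : ∀ y ∈ R, -y c ≤ -x₀ c + 0 * T := by
      refine reachable_le_of_deriv_le (V := fun y : State => -y c) (smooth (by fun_prop)) le_rfl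
        (ae_of_all _ fun t X _ _ hX => ?_)
      rw [unforcedLoop_add_gridForcing] at hX
      refine ⟨_, (hasDerivAt_pi.1 hX c).neg, ?_⟩
      rw [hc]
      have : 0 ≤ Γ * Real.exp (-X t c) * max (W (X t) - D.ε) 0 := by positivity
      linarith
    have hup : ∀ y ∈ R, y c ≤ x₀ c + Γ * Real.exp (-x₀ c) * max (B - D.ε) 0 * T := by
      refine reachable_le_of_deriv_le (V := fun y : State => y c) (smooth (by fun_prop))
        (by positivity) (ae_of_all _ fun t X _ hXR hX => ?_)
      rw [unforcedLoop_add_gridForcing] at hX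
      refine ⟨_, hasDerivAt_pi.1 hX c, ?_⟩
      rw [hc]
      have h1 := hlow _ hXR
      have h2 := hB _ hXR
      rw [zero_mul, add_zero] at h1
      gcongr
    refine ⟨max (x₀ c + Γ * Real.exp (-x₀ c) * max (B - D.ε) 0 * T) (-x₀ c + 0 * T),
      fun y hy => abs_le'.2 ⟨(hup y hy).trans (le_max_left _ _),
        (hlow y hy).trans (le_max_right _ _)⟩⟩
  have hzd : BddOn R fun y => y .zd := adapt _ D.Γd (Wd F D) hΓd hWd fun x vd vq => rfl
  have hzq : BddOn R fun y => y .zq := adapt _ D.Γq (Wq F D) hΓq hWq fun x vd vq => rfl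
  have hall : ∀ c : Coord, BddOn R fun y => y c := by
    intro c
    cases c <;> assumption
  choose B hB0 hB using fun c => (hall c).exists_nonneg
  refine ⟨∑ c, B c, fun y hy => ?_⟩
  rw [pi_norm_le_iff_of_nonneg (Finset.sum_nonneg fun c _ => hB0 c)]
  intro c
  exact (hB c y hy).trans (Finset.single_le_sum (fun c _ => hB0 c) (Finset.mem_univ c))

end GFM

/-! ### Asymptotics under the adaptive gain. -/

section Adaptive

open Set

/-- A nonnegative storage function whose disturbance is attenuated by an adaptive gain that grows
as long as the function exceeds `ε` is eventually below `ε + δ`. -/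
theorem eventually_le_of_adaptive_gain {W z : ℝ → ℝ} {k M Γ ε δ : ℝ} (hk : 0 < k) (hM : 0 ≤ M)
    (hΓ : 0 < Γ) (hε : 0 < ε) (hδ : 0 < δ) (hW0 : ∀ t, 0 ≤ W t)
    (hWac : ∀ T, 0 ≤ T → AbsolutelyContinuousOnInterval W 0 T)
    (hzac : ∀ T, 0 ≤ T → AbsolutelyContinuousOnInterval z 0 T)
    (hW : ∀ᵐ t, 0 ≤ t →
      ∃ W', HasDerivAt W W' t ∧ W' ≤ -(2 * k) * W t + M / (1 + Real.exp (z t)))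
    (hz : ∀ᵐ t, 0 ≤ t → HasDerivAt z (Γ * Real.exp (-z t) * max (W t - ε) 0) t) :
    ∀ᶠ t in atTop, W t ≤ ε + δ := by
  have sub : ∀ {a b : ℝ}, 0 ≤ a → a ≤ b → uIcc a b ⊆ uIcc 0 b := fun ha hab => by
    rw [uIcc_of_le hab, uIcc_of_le (ha.trans hab)]
    exact Icc_subset_Icc_left ha
  have zmono : ∀ a b, 0 ≤ a → a ≤ b → z a ≤ z b := by
    intro a b ha hab
    have := ((hzac b (ha.trans hab)).mono (sub ha hab)).fun_neg.le_of_ae_deriv_nonpos hab (by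
      filter_upwards [hz] with t ht htm
      refine ⟨_, (ht (ha.trans htm.1)).neg, ?_⟩
      have : 0 ≤ Γ * Real.exp (-z t) * max (W t - ε) 0 := by positivity
      linarith)
    linarith
  by_cases hb : ∃ Z, ∀ t, 0 ≤ t → z t ≤ Z
  · obtain ⟨Z, hZ⟩ := hb
    have hWM : ∀ a b, 0 ≤ a → a ≤ b → W b ≤ W a + M * (b - a) := by
      intro a b ha hab
      refine ((hWac b (ha.trans hab)).mono (sub ha hab)).le_add_of_ae_deriv_le hab ?_
      filter_upwards [hW] with t ht htm
      obtain ⟨W', h1, h2⟩ := ht (ha.trans htm.1)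
      refine ⟨W', h1, h2.trans ?_⟩
      have h3 := div_le_self hM (show 1 ≤ 1 + Real.exp (z t) by linarith [Real.exp_pos (z t)])
      have h4 := mul_nonneg hk.le (hW0 t)
      linarith
    -- During a window of length `τ` the function `W` rises by at most `δ / 2`. So `W t > ε + δ`
    -- forces `W > ε + δ / 2` on `[t - τ, t]`, where `z` then grows at rate at least `r`. The `M +
    -- 1` covers `M = 0`.
    set τ := δ / (2 * (M + 1)) with hτdef
    have hτ : 0 < τ := by positivity
    have hMτ : M * τ ≤ δ / 2 := by
      have : (M + 1) * τ = δ / 2 := by rw [hτdef]; field_simp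
      linarith
    set r := Γ * Real.exp (-Z) * (δ / 2) with hr
    have hr0 : 0 < r := by positivity
    have hne : (z '' Ici 0).Nonempty := ⟨z 0, 0, self_mem_Ici, rfl⟩
    have hbd : BddAbove (z '' Ici 0) := ⟨Z, by rintro _ ⟨t, ht, rfl⟩; exact hZ t ht⟩
    -- From `t₀` on, `z` is within `r τ` of its supremum, leaving no room for such a window.
    obtain ⟨_, ⟨t₀, ht₀, rfl⟩, hlt⟩ :=
      exists_lt_of_lt_csSup hne (sub_lt_self (sSup (z '' Ici 0)) (mul_pos hr0 hτ))
    rw [mem_Ici] at ht₀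
    filter_upwards [eventually_ge_atTop (t₀ + τ)] with t ht
    by_contra! hcon
    have ha : 0 ≤ t - τ := by linarith
    have hab : t - τ ≤ t := by linarith
    have h1 := ((hzac t (ha.trans hab)).mono (sub ha hab)).fun_neg.le_add_of_ae_deriv_le
      (m := -r) hab (by
      filter_upwards [hz] with s hs hsm
      have hs0 := ha.trans hsm.1
      refine ⟨_, (hs hs0).neg, ?_⟩
      have h2 := hWM s t hs0 hsm.2
      have h3 : M * (t - s) ≤ M * τ := by
        have := hsm.1
        gcongr
        linarith
      have h4 : δ / 2 ≤ max (W s - ε) 0 := le_max_of_le_left (by linarith)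
      have h5 := hZ s hs0
      have : r ≤ Γ * Real.exp (-z s) * max (W s - ε) 0 := by
        rw [hr]
        gcongr
      linarith)
    have h2 : z t ≤ sSup (z '' Ici 0) := le_csSup hbd ⟨t, ha.trans hab, rfl⟩
    have h3 := zmono t₀ (t - τ) ht₀ (by linarith)
    linarith
  · push Not at hb
    -- Past this threshold `1 + exp z ≥ z ≥ M / (k δ)`, so the disturbance is at most `k δ` and
    -- contributes `δ / 2` to `W`; the other `δ / 2` absorbs the transient.
    obtain ⟨t₀, ht₀, hlt⟩ := hb (M / (k * δ))
    have hWt : ∀ t, t₀ ≤ t →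
        W t ≤ Real.exp (-(2 * k) * (t - t₀)) * (W t₀ - k * δ / (2 * k)) + k * δ / (2 * k) := by
      intro t ht
      refine ((hWac t (ht₀.trans ht)).mono (sub ht₀ ht)).gronwall_le ht (by positivity) ?_
      filter_upwards [hW] with s hs hsm
      obtain ⟨W', h1, h2⟩ := hs (ht₀.trans hsm.1)
      refine ⟨W', h1, h2.trans ?_⟩
      have h3 := zmono t₀ s ht₀ hsm.1
      have h4 := Real.add_one_le_exp (z s)
      have h5 : M / (1 + Real.exp (z s)) ≤ k * δ := by
        rw [div_lt_iff₀ (by positivity)] at hlt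
        rw [div_le_iff₀ (by positivity)]
        have h6 : z t₀ * (k * δ) ≤ (1 + Real.exp (z s)) * (k * δ) := by
          gcongr
          linarith
        linarith
      linarith
    have hlim : Tendsto (fun t => Real.exp (-(2 * k) * (t - t₀)) * (W t₀ - k * δ / (2 * k)))
        atTop (nhds 0) := by
      have h1 : Tendsto (fun t => -(2 * k) * (t - t₀)) atTop atBot :=
        (tendsto_atTop_add_const_right atTop (-t₀) tendsto_id).const_mul_atTop_of_neg
          (by linarith)
      simpa using (Real.tendsto_exp_atBot.comp h1).mul_const (W t₀ - k * δ / (2 * k))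
    filter_upwards [eventually_ge_atTop t₀, hlim.eventually_le_const (half_pos hδ)] with t ht ht'
    have h1 := hWt t ht
    have h2 : k * δ / (2 * k) = δ / 2 := by field_simp
    linarith

/-- In `EReal` the limsup is meaningful without a separate proof of boundedness. -/
theorem limsup_abs_le_sqrt {g W : ℝ → ℝ} {ε : ℝ} (hg : ∀ t, g t ^ 2 ≤ 2 * W t)
    (hW : ∀ δ > 0, ∀ᶠ t in atTop, W t ≤ ε + δ) :
    limsup (fun t : ℝ => ((|g t| : ℝ) : EReal)) atTop ≤ ((Real.sqrt (2 * ε) : ℝ) : EReal) := by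
  refine le_of_forall_gt_imp_ge_of_dense fun c hc => ?_
  obtain ⟨r, hr, hrc⟩ := EReal.lt_iff_exists_real_btwn.1 hc
  have hr' : Real.sqrt (2 * ε) < r := by exact_mod_cast hr
  have hr0 : 0 < r := (Real.sqrt_nonneg _).trans_lt hr'
  have hδ : 2 * ε < r ^ 2 := (Real.sqrt_lt' hr0).1 hr'
  refine limsup_le_of_le (h := ?_)
  -- This `δ` makes `2 (ε + δ) = r²`.
  filter_upwards [hW (r ^ 2 / 2 - ε) (by linarith)] with t ht
  refine le_trans ?_ hrc.le
  have : |g t| ≤ r := abs_le_of_sq_le_sq (by linarith [hg t]) hr0.le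
  exact_mod_cast this

end Adaptive

/-! ### The grid voltage as forcing, well-posedness, and the final assembly. -/

namespace GFM

open Set

variable {F : FilterParams} {N : NetworkParams} {D : DesignParams} {x₀ : State} {vgd vgq : ℝ → ℝ}

theorem MemLinfty.ae_abs_le {v : ℝ → ℝ} (hv : MemLinfty v) :
    ∀ᵐ t, 0 ≤ t → |v t| ≤ normLinfty v := by
  have h := enorm_ae_le_eLpNormEssSup v (volume.restrict (Ici (0 : ℝ)))
  rw [ae_restrict_iff' measurableSet_Ici] at h
  filter_upwards [h] with t ht ht0
  have h1 := ENNReal.toReal_mono hv.eLpNorm_lt_top.ne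
    ((ht ht0).trans_eq eLpNorm_exponent_top.symm)
  simpa [normLinfty] using h1

theorem MemLinfty.intervalIntegrable {v : ℝ → ℝ} (hv : MemLinfty v) {T : ℝ} (hT : 0 ≤ T) :
    IntervalIntegrable v volume 0 T := by
  rw [intervalIntegrable_iff_integrableOn_Icc_of_le hT]
  have h : MemLp v ⊤ (volume.restrict (Icc 0 T)) :=
    MemLp.mono_measure (Measure.restrict_mono Icc_subset_Ici_self le_rfl) hv
  exact h.integrable le_top

/-- A primitive of the grid forcing. -/
noncomputable def gridPrimitive (F : FilterParams) (N : NetworkParams) (vgd vgq : ℝ → ℝ) :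
    ℝ → State :=
  gridForcing F N (fun t => ∫ s in (0 : ℝ)..t, vgd s) (fun t => ∫ s in (0 : ℝ)..t, vgq s)

theorem gridPrimitive_zero : gridPrimitive F N vgd vgq 0 = 0 := by
  simp [gridPrimitive, gridForcing]

theorem absolutelyContinuousOnInterval_gridPrimitive (hd : MemLinfty vgd) (hq : MemLinfty vgq)
    {T : ℝ} (hT : 0 ≤ T) : AbsolutelyContinuousOnInterval (gridPrimitive F N vgd vgq) 0 T :=
  (((hd.intervalIntegrable hT).absolutelyContinuousOnInterval_intervalIntegral
    left_mem_uIcc).fun_smul (absolutelyContinuousOnInterval_const _ _ _)).fun_add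
  (((hq.intervalIntegrable hT).absolutelyContinuousOnInterval_intervalIntegral
    left_mem_uIcc).fun_smul (absolutelyContinuousOnInterval_const _ _ _))

theorem ae_hasDerivAt_gridPrimitive (hd : MemLinfty vgd) (hq : MemLinfty vgq)
    {T : ℝ} (hT : 0 ≤ T) : ∀ᵐ t, t ∈ Icc 0 T →
      HasDerivAt (gridPrimitive F N vgd vgq) (gridForcing F N vgd vgq t) t := by
  filter_upwards [(hd.intervalIntegrable hT).ae_hasDerivAt_integral,
    (hq.intervalIntegrable hT).ae_hasDerivAt_integral] with t h1 h2 ht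
  rw [← uIcc_of_le hT] at ht
  exact ((h1 ht 0 left_mem_uIcc).smul_const _).add ((h2 ht 0 left_mem_uIcc).smul_const _)

theorem isSolution_iff {X : ℝ → State} : IsSolution F N D x₀ vgd vgq X ↔
    ∀ T, 0 ≤ T → IsACSolOn (unforcedLoop F N D) (gridForcing F N vgd vgq) x₀ T X := by
  constructor
  · intro h T hT
    refine ⟨h.init, h.absCont T hT, ?_⟩
    filter_upwards [(ae_restrict_iff' measurableSet_Ici).1 h.ode] with t ht htm
    rw [unforcedLoop_add_gridForcing]
    exact ht htm.1
  · intro h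
    refine ⟨(h 0 le_rfl).init, fun T hT => (h T hT).ac, ?_⟩
    rw [ae_restrict_iff' measurableSet_Ici]
    -- Integer horizons suffice, so the exceptional set is a countable union of null sets.
    have := ae_all_iff.2 fun n : ℕ => (h n n.cast_nonneg).ode
    filter_upwards [this] with t ht ht0
    rw [← unforcedLoop_add_gridForcing]
    exact ht ⌈t⌉₊ ⟨ht0, Nat.le_ceil t⟩

/-- Exponential decay up to a residual for a storage function with bounded disturbance. -/
theorem two_mul_le_exp_decay {W z : ℝ → ℝ} {k M t : ℝ} (hk : 0 < k) (hM : 0 ≤ M) (ht : 0 ≤ t)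
    (hWac : AbsolutelyContinuousOnInterval W 0 t)
    (hW : ∀ᵐ s, 0 ≤ s →
      ∃ W', HasDerivAt W W' s ∧ W' ≤ -(2 * k) * W s + M / (1 + Real.exp (z s))) :
    2 * W t ≤ 2 * Real.exp (-2 * k * t) * W 0 + M / k := by
  have h := hWac.gronwall_le (c := 2 * k) (m := M) ht (by positivity) (by
    filter_upwards [hW] with s hs hsm
    obtain ⟨W', h1, h2⟩ := hs hsm.1
    refine ⟨W', h1, h2.trans ?_⟩
    gcongr
    exact div_le_self hM (by linarith [Real.exp_pos (z s)]))
  have h1 : 0 ≤ Real.exp (-(2 * k) * (t - 0)) * (M / (2 * k)) := by positivity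
  have h2 : M / k = 2 * (M / (2 * k)) := by field_simp
  have h3 : -(2 * k) * (t - 0) = -2 * k * t := by ring
  rw [h3] at h h1
  linarith

theorem isSolution_unique (hQ : 0 < D.Qbar) (hP : 0 < D.Pbar) (hd : MemLinfty vgd)
    (hq : MemLinfty vgq) {X Y : ℝ → State} (hX : IsSolution F N D x₀ vgd vgq X)
    (hY : IsSolution F N D x₀ vgd vgq Y) {t : ℝ} (ht : 0 ≤ t) : Y t = X t :=
  (isSolution_iff.1 hY t ht).eqOn (isSolution_iff.1 hX t ht) ht
    (locallyLipschitz_closedLoop hQ hP) (absolutelyContinuousOnInterval_gridPrimitive hd hq ht)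
    (ae_hasDerivAt_gridPrimitive hd hq ht) (right_mem_Icc.2 ht)

theorem exists_isSolution (hωb : 0 < F.ωb) (hCf : 0 < F.Cf) (hLf : 0 < F.Lf)
    (hL : 0 < N.L) (hR : 0 < N.R) (hKVC : 0 < D.KVC) (hKCC : 0 < D.KCC) (hμd : 0 < D.μd)
    (hμq : 0 < D.μq) (hΓd : 0 < D.Γd) (hΓq : 0 < D.Γq)
    (hωpc : 0 < D.ωpc) (hωqc : 0 < D.ωqc) (hξp : 0 < D.ξp) (hξq : 0 < D.ξq)
    (hQbar : 0 < D.Qbar) (hPbar : 0 < D.Pbar) (hd : MemLinfty vgd) (hq : MemLinfty vgq)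
    (x₀ : State) : ∃ X, IsSolution F N D x₀ vgd vgq X := by
  have hf : LocallyLipschitz (unforcedLoop F N D) := locallyLipschitz_closedLoop hQbar hPbar
  obtain ⟨X, hX⟩ := IsACSolOn.exists_global (x₀ := x₀) hf
    (fun T hT => absolutelyContinuousOnInterval_gridPrimitive (F := F) (N := N) hd hq hT)
    (fun T hT => ae_hasDerivAt_gridPrimitive hd hq hT) fun T hT => by
      obtain ⟨B, hB⟩ := exists_bound_reachable hωb hCf hLf hL hR hKVC hKCC hμd hμq hΓd hΓq hωpc
        hωqc hξp hξq hQbar hPbar hd.ae_abs_le hq.ae_abs_le x₀ T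
      exact IsACSolOn.exists_of_bound hT hf
        (absolutelyContinuousOnInterval_gridPrimitive hd hq hT) gridPrimitive_zero
        (ae_hasDerivAt_gridPrimitive hd hq hT) fun S hS X hX => hB _ ⟨S, hS, X, hX, rfl⟩
  exact ⟨X, isSolution_iff.2 hX⟩

theorem IsSolution.absCont_comp {X : ℝ → State} (h : IsSolution F N D x₀ vgd vgq X) {g : State → ℝ}
    (hg : LocallyLipschitz g) (T : ℝ) (hT : 0 ≤ T) :
    AbsolutelyContinuousOnInterval (fun t => g (X t)) 0 T :=
  hg.comp_absolutelyContinuousOnInterval (h.absCont T hT)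

theorem locallyLipschitz_coord (c : Coord) : LocallyLipschitz fun x : State => x c :=
  ContDiff.locallyLipschitz (𝕂 := ℝ) (by fun_prop)

end GFM

theorem theorem2
    (F : GFM.FilterParams) (N : GFM.NetworkParams) (D : GFM.DesignParams)
    (hωb : 0 < F.ωb) (hCf : 0 < F.Cf) (hLf : 0 < F.Lf) (hRf : 0 < F.Rf)
    (hL : 0 < N.L) (hR : 0 < N.R)
    (hKVC : 0 < D.KVC) (hKCC : 0 < D.KCC) (hμd : 0 < D.μd) (hμq : 0 < D.μq)
    (hΓd : 0 < D.Γd) (hΓq : 0 < D.Γq) (hε : 0 < D.ε)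
    (hωpc : 0 < D.ωpc) (hωqc : 0 < D.ωqc) (hξp : 1 < D.ξp) (hξq : 1 < D.ξq)
    (hQbar : 0 < D.Qbar) (hPbar : 0 < D.Pbar)
    (vgd vgq : ℝ → ℝ) (hvgd : GFM.MemLinfty vgd) (hvgq : GFM.MemLinfty vgq)
    (x₀ : GFM.State) (k : ℝ) (hk : k = min D.KVC D.KCC) :
    ∃ X : ℝ → GFM.State,
      GFM.IsSolution F N D x₀ vgd vgq X ∧
      (∀ Y : ℝ → GFM.State, GFM.IsSolution F N D x₀ vgd vgq Y → ∀ t : ℝ, 0 ≤ t → Y t = X t) ∧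
      (∀ t : ℝ, 0 ≤ t →
        (X t .vcd - GFM.vcdRef D (X t)) ^ 2 ≤ 2 * GFM.Wd F D (X t) ∧
        2 * GFM.Wd F D (X t) ≤
          2 * Real.exp (-2 * k * t) * GFM.Wd F D (X 0)
            + D.μd * (1 + N.R ^ 2 + GFM.normLinfty vgd ^ 2) / (k * N.L ^ 2)) ∧
      (∀ t : ℝ, 0 ≤ t →
        X t .vcq ^ 2 ≤ 2 * GFM.Wq F D (X t) ∧
        2 * GFM.Wq F D (X t) ≤
          2 * Real.exp (-2 * k * t) * GFM.Wq F D (X 0)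
            + D.μq * (1 + N.R ^ 2 + GFM.normLinfty vgq ^ 2) / (k * N.L ^ 2)) ∧
      limsup (fun t : ℝ => ((|X t .vcd - GFM.vcdRef D (X t)| : ℝ) : EReal)) atTop
        ≤ ((Real.sqrt (2 * D.ε) : ℝ) : EReal) ∧
      limsup (fun t : ℝ => ((|X t .vcq| : ℝ) : EReal)) atTop
        ≤ ((Real.sqrt (2 * D.ε) : ℝ) : EReal) := by
  have hk0 : 0 < k := hk ▸ lt_min hKVC hKCC
  obtain ⟨X, hX⟩ := GFM.exists_isSolution hωb hCf hLf hL hR hKVC hKCC hμd hμq hΓd hΓq hωpc hωqc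
    (one_pos.trans hξp) (one_pos.trans hξq) hQbar hPbar hvgd hvgq x₀
  have hode := (ae_restrict_iff' measurableSet_Ici).1 hX.ode
  have hWdac := hX.absCont_comp (GFM.locallyLipschitz_Wd (F := F) (D := D))
  have hWqac := hX.absCont_comp (GFM.locallyLipschitz_Wq (F := F) (D := D))
  have hWd' : ∀ᵐ t, 0 ≤ t → ∃ W', HasDerivAt (fun t => GFM.Wd F D (X t)) W' t ∧
      W' ≤ -(2 * k) * GFM.Wd F D (X t)
        + D.μd * (1 + N.R ^ 2 + GFM.normLinfty vgd ^ 2) / N.L ^ 2 / (1 + Real.exp (X t .zd)) := by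
    filter_upwards [hode, hvgd.ae_abs_le] with t h1 h2 ht
    exact GFM.exists_hasDerivAt_Wd_le hωb hCf hLf hL hμd hk (h2 ht) (h1 ht)
  have hWq' : ∀ᵐ t, 0 ≤ t → ∃ W', HasDerivAt (fun t => GFM.Wq F D (X t)) W' t ∧
      W' ≤ -(2 * k) * GFM.Wq F D (X t)
        + D.μq * (1 + N.R ^ 2 + GFM.normLinfty vgq ^ 2) / N.L ^ 2 / (1 + Real.exp (X t .zq)) := by
    filter_upwards [hode, hvgq.ae_abs_le] with t h1 h2 ht
    exact GFM.exists_hasDerivAt_Wq_le hωb hCf hLf hL hμq hk (h2 ht) (h1 ht)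
  have hzd : ∀ᵐ t, 0 ≤ t → HasDerivAt (fun t => X t .zd)
      (D.Γd * Real.exp (-X t .zd) * max (GFM.Wd F D (X t) - D.ε) 0) t := by
    filter_upwards [hode] with t h1 ht using hasDerivAt_pi.1 (h1 ht) .zd
  have hzq : ∀ᵐ t, 0 ≤ t → HasDerivAt (fun t => X t .zq)
      (D.Γq * Real.exp (-X t .zq) * max (GFM.Wq F D (X t) - D.ε) 0) t := by
    filter_upwards [hode] with t h1 ht using hasDerivAt_pi.1 (h1 ht) .zq
  have hed : ∀ t, (X t .vcd - GFM.vcdRef D (X t)) ^ 2 ≤ 2 * GFM.Wd F D (X t) := fun t => by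
    unfold GFM.Wd; nlinarith [sq_nonneg (X t .itd - GFM.itdRef F D (X t))]
  have heq : ∀ t, X t .vcq ^ 2 ≤ 2 * GFM.Wq F D (X t) := fun t => by
    unfold GFM.Wq; nlinarith [sq_nonneg (X t .itq - GFM.itqRef F D (X t))]
  refine ⟨X, hX, fun Y hY t ht => GFM.isSolution_unique hQbar hPbar hvgd hvgq hX hY ht,
    fun t ht => ⟨hed t, ?_⟩, fun t ht => ⟨heq t, ?_⟩,
    limsup_abs_le_sqrt hed fun δ hδ => ?_, limsup_abs_le_sqrt heq fun δ hδ => ?_⟩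
  -- Writes the residual as `M / k` with `M` the disturbance constant already divided by `L²`.
  · rw [mul_comm k, ← div_div]
    exact GFM.two_mul_le_exp_decay hk0 (by positivity) ht (hWdac t ht) hWd'
  · rw [mul_comm k, ← div_div]
    exact GFM.two_mul_le_exp_decay hk0 (by positivity) ht (hWqac t ht) hWq'
  · exact eventually_le_of_adaptive_gain hk0 (by positivity) hΓd hε hδ
      (fun t => GFM.Wd_nonneg _) hWdac (hX.absCont_comp (GFM.locallyLipschitz_coord .zd)) hWd' hzd
  · exact eventually_le_of_adaptive_gain hk0 (by positivity) hΓq hε hδ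
      (fun t => GFM.Wq_nonneg _) hWqac (hX.absCont_comp (GFM.locallyLipschitz_coord .zq)) hWq' hzq
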